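/- **Theorem (Quantum multiplicative 2-norm estimator).** There is a universal constant $C>0$ such that the following holds. Let $G$ be a simple graph on $N\ge 2$ nodes with all degrees $d_v\le d$, $d\ge1$, and let $P$ be the lazy symmetric random walk on $G$: $P(v,w)=\frac1{2d}$ if $vw$ is an edge, $P(v,v)=1-\frac{d_v}{2d}$, and $P(v,w)=0$ otherwise. Let $u$ be a node, $t\ge 0$ an integer, $\varepsilon>0$, $0<\delta<1$, and $p=P^t|u\rangle$ the distribution of the $t$-step walk started in $u$, with Euclidean norm $\|p\|$. *Quantum walk.* On the space with basis $|i,x\rangle$, $i\in\mathcal V$, $x\in\{\flat\}\cup\mathcal V$, let $V=\sum_i|i\rangle\langle i|\otimes V_i$ with arbitrary unitaries $V_i$ such that $V_i|\flat\rangle=\sum_j\sqrt{P(j,i)}\,|j\rangle$; let $S|i,j\rangle=|j,i\rangle$ if $ij$ is an edge and let $S$ fix all other basis states; let $\Pi_\flat=I\otimes|\flat\rangle\langle\flat|$. A quantum walk (QW) step is one application of $W=(2\Pi_\flat-I)V^\dagger SV$ or $W^\dagger$, possibly controlled on ancilla registers. Operations that do not depend on the graph cost no QW steps. *Additive estimator*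 with error $\eta$ and confidence $\delta'$. Put $\tau=\lceil\sqrt{2t\ln(8\sqrt N/\eta)}\,\rceil$ (with $\tau=0$ if the logarithm is negative). Let $x^t=\sum_{l=0}^t p_lT_l(x)$ be the Chebyshev expansion, $q_l=p_l/(1-\sum_{j>\tau}p_j)$ for $0\le l\le\tau$, $V_q$ a unitary with $V_q|0\rangle=\sum_l\sqrt{q_l}\,|l\rangle$ on an ancilla, and $W_\tau=V_q^\dagger\big(\sum_{l\le\tau}W^l\otimes|l\rangle\langle l|\big)V_q$. Use amplitude estimation to estimate the norm of the projection of $|\psi\rangle=W_\tau|u,\flat,0\rangle$ on the span of the states $|i,\flat,0\rangle$ to error $\eta/2$. That is, run $\lceil 18\ln(1/\delta')\rceil$ times independently the phase-estimation circuit for $-R_\psi R_\flat$, where $R_\psi$ and $R_\flat$ are the reflections around $|\psi\rangle$ and around that span, with a phase register of dimension $M=\lceil 24\pi/\eta\rceil+1$. Outcome $y$ gives the estimate $\sin(\pi y/M)$. Return the first estimate $a$ such that at least two thirds of the estimates lie in $[a,a+\eta/3]$ (and $0$ if there is none). *Multiplicative estimator.* Put $T=\lceil\frac12\log_2N\rceil$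 and $\delta'=\delta/T$. For $k=1,\dots,T$: let $\alpha$ be the output of the additive estimator with error $\varepsilon_k=\varepsilon 2^{-k-2}$ and confidence $\delta'$; if $\alpha\ge(1+\varepsilon)2^{-k}$, leave the loop. Output the last $\alpha$. (No bound on $\|p\|$ is given to the algorithm.) Then: 1. with probability at least $1-\delta$, the output $\alpha$ satisfies $\big|\,\|P^t|u\rangle\|-\alpha\,\big|\le\varepsilon\,\|P^t|u\rangle\|$; 2. if moreover $\varepsilon\le1$ and $\delta\le\frac12$, the expected number of QW steps that the algorithm uses is at most $$C\,\frac{\sqrt t}{\varepsilon\|p\|}\,\log\!\Big(\frac{\log N}{\delta}\Big)\,\log^{1/2}\!\Big(\frac N\varepsilon\Big).$$ -/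

import Mathlib

open scoped Kronecker

noncomputable section

namespace QFF

/-! ### Unitary building blocks -/

section Unitary

variable {ι : Type} [Fintype ι] [DecidableEq ι]

/-- The Householder reflection `1 - 2 w wᵀ / (wᵀ w)` for `w = e_{i₀} - ψ` (the identity if `w = 0`).
If `ψ` is a real unit vector, this is a unitary matrix whose column at `i₀` is `ψ`. -/
def householderMatrix (i₀ : ι) (ψ : ι → ℝ) : Matrix ι ι ℂ := fun i j =>
  let w : ι → ℝ := fun k => (if k = i₀ then 1 else 0) - ψ k
  (((if i = j then 1 else 0) - 2 * w i * w j / ∑ k, w k ^ 2 : ℝ) : ℂ)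

theorem householder_mem (i₀ : ι) (ψ : ι → ℝ) :
    householderMatrix i₀ ψ ∈ Matrix.unitaryGroup ι ℂ := by
  rw [Matrix.mem_unitaryGroup_iff]
  set w : ι → ℝ := fun k => (if k = i₀ then 1 else 0) - ψ k with hw
  set s : ℝ := ∑ k, w k ^ 2 with hs
  have hdef : ∀ i j, householderMatrix i₀ ψ i j
      = (((if i = j then 1 else 0) - 2 * w i * w j / s : ℝ) : ℂ) := by
    intro i j
    rfl
  ext i j
  rw [Matrix.mul_apply]
  simp only [Matrix.star_apply, hdef, RCLike.star_def, Complex.conj_ofReal]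
  rw [Matrix.one_apply]
  have key : ∑ k, ((if i = k then (1 : ℝ) else 0) - 2 * w i * w k / s)
      * ((if j = k then 1 else 0) - 2 * w j * w k / s) = if i = j then 1 else 0 := by
    have e : ∀ k, ((if i = k then (1 : ℝ) else 0) - 2 * w i * w k / s)
      * ((if j = k then 1 else 0) - 2 * w j * w k / s)
      = (if i = k then (if j = k then (1 : ℝ) else 0) else 0)
        - (if i = k then 2 * w j * w k / s else 0)
        - (if j = k then 2 * w i * w k / s else 0)
        + 4 * w i * w j / s ^ 2 * w k ^ 2 := by
      intro k
      split_ifs <;> ring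
    simp only [e, Finset.sum_add_distrib, Finset.sum_sub_distrib, ← Finset.mul_sum, ← hs]
    simp only [Finset.sum_ite_eq, Finset.mem_univ, if_true]
    have e2 : 4 * w i * w j / s ^ 2 * s = 4 * (w i * w j / s) := by
      by_cases h0 : s = 0
      · simp [h0]
      · field_simp
    rw [e2]
    have e3 : (if j = i then (1 : ℝ) else 0) = if i = j then 1 else 0 := by
      simp only [eq_comm]
    rw [e3]
    ring
  have := congrArg (fun x : ℝ => (x : ℂ)) key
  simp only [Complex.ofReal_sum, Complex.ofReal_mul] at this
  rw [this]
  split_ifs <;> simp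

def householder (i₀ : ι) (ψ : ι → ℝ) : Matrix.unitaryGroup ι ℂ :=
  ⟨householderMatrix i₀ ψ, householder_mem i₀ ψ⟩

/-- Multiplication by `-1` of the basis states that satisfy `s`. -/
def signFlip (s : ι → Prop) [DecidablePred s] : Matrix.unitaryGroup ι ℂ :=
  ⟨Matrix.diagonal fun z => if s z then -1 else 1, by
    rw [Matrix.mem_unitaryGroup_iff, Matrix.star_eq_conjTranspose, Matrix.diagonal_conjTranspose,
      Matrix.diagonal_mul_diagonal, ← Matrix.diagonal_one]
    congr 1
    funext z
    by_cases h : s z <;> simp [h]⟩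

/-- The block-diagonal unitary that acts as `B a` on the first register
if the second register is in the basis state `a`. -/
def select {A : Type} [Fintype A] [DecidableEq A] (B : A → Matrix.unitaryGroup ι ℂ) :
    Matrix.unitaryGroup (ι × A) ℂ :=
  ⟨Matrix.blockDiagonal fun a => (B a : Matrix ι ι ℂ), by
    rw [Matrix.mem_unitaryGroup_iff, Matrix.star_eq_conjTranspose,
      Matrix.blockDiagonal_conjTranspose, ← Matrix.blockDiagonal_mul,
      ← Matrix.blockDiagonal_one]
    congr 1
    funext a
    exact Matrix.mem_unitaryGroup_iff.1 (B a).2⟩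

/-- The tensor product of two unitaries. -/
def tensor {κ : Type} [Fintype κ] [DecidableEq κ] (U : Matrix.unitaryGroup ι ℂ)
    (V : Matrix.unitaryGroup κ ℂ) : Matrix.unitaryGroup (ι × κ) ℂ :=
  ⟨(U : Matrix ι ι ℂ) ⊗ₖ (V : Matrix κ κ ℂ), Matrix.kronecker_mem_unitary U.2 V.2⟩

/-- Renaming of the basis states along a bijection. -/
def relabel {κ : Type} [Fintype κ] [DecidableEq κ] (e : κ ≃ ι) (U : Matrix.unitaryGroup ι ℂ) :
    Matrix.unitaryGroup κ ℂ :=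
  ⟨(U : Matrix ι ι ℂ).submatrix e e, by
    rw [Matrix.mem_unitaryGroup_iff, Matrix.star_eq_conjTranspose, Matrix.conjTranspose_submatrix,
      Matrix.submatrix_mul_equiv, ← Matrix.star_eq_conjTranspose,
      Matrix.mem_unitaryGroup_iff.1 U.2, Matrix.submatrix_one_equiv]⟩

/-- The permutation `σ` of the basis states, as a unitary `|z⟩ ↦ |σ z⟩`. -/
def permUnitary (σ : Equiv.Perm ι) : Matrix.unitaryGroup ι ℂ :=
  ⟨Matrix.of fun z z' => if z = σ z' then 1 else 0, by
    rw [Matrix.mem_unitaryGroup_iff]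
    ext z z'
    rw [Matrix.mul_apply, Matrix.one_apply, ← σ.symm.sum_comp]
    simp [Matrix.star_apply, apply_ite, eq_comm]⟩

/-- The quantum Fourier transform `|x⟩ ↦ (m+1)^{-1/2} ∑_y exp(2πi x y / (m+1)) |y⟩`. -/
def qftMatrix (m : ℕ) : Matrix (Fin (m + 1)) (Fin (m + 1)) ℂ := fun y x =>
  Complex.exp (2 * Real.pi * Complex.I * (x : ℕ) * (y : ℕ) / ((m : ℂ) + 1)) /
    (Real.sqrt ((m : ℝ) + 1) : ℂ)

theorem qftMatrix_mem (m : ℕ) : qftMatrix m ∈ Matrix.unitaryGroup (Fin (m + 1)) ℂ := by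
  have hM : ((m : ℂ) + 1) ≠ 0 := by exact_mod_cast Nat.succ_ne_zero m
  set ζ : ℂ := Complex.exp (2 * Real.pi * Complex.I / ((m + 1 : ℕ) : ℂ)) with hζ
  have hprim : IsPrimitiveRoot ζ (m + 1) := Complex.isPrimitiveRoot_exp _ (Nat.succ_ne_zero m)
  have hconj : (starRingEnd ℂ) ζ = ζ⁻¹ := by
    rw [hζ, ← Complex.exp_conj, ← Complex.exp_neg]
    congr 1
    simp only [map_div₀, map_mul, Complex.conj_I, Complex.conj_ofReal, map_natCast, map_ofNat]
    ring
  have hval : ∀ x y : Fin (m + 1), qftMatrix m y x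
      = (ζ ^ (y : ℕ)) ^ (x : ℕ) / (Real.sqrt ((m : ℝ) + 1) : ℂ) := by
    intro x y
    rw [qftMatrix, hζ, ← Complex.exp_nat_mul, ← Complex.exp_nat_mul]
    congr 2
    push_cast
    field_simp
  have hsq : (Real.sqrt ((m : ℝ) + 1) : ℂ) * (Real.sqrt ((m : ℝ) + 1) : ℂ) = (m : ℂ) + 1 := by
    rw [← Complex.ofReal_mul, Real.mul_self_sqrt (by positivity)]
    push_cast
    rfl
  have hζ0 : ζ ≠ 0 := Complex.exp_ne_zero _
  rw [Matrix.mem_unitaryGroup_iff]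
  ext y z
  rw [Matrix.mul_apply]
  have hterm : ∀ x : Fin (m + 1), qftMatrix m y x * (star (qftMatrix m)) x z
      = (ζ ^ (y : ℕ) * (ζ ^ (z : ℕ))⁻¹) ^ (x : ℕ) / ((m : ℂ) + 1) := by
    intro x
    rw [Matrix.star_apply, hval, hval, RCLike.star_def, map_div₀, map_pow, map_pow, hconj,
      Complex.conj_ofReal, div_mul_div_comm, hsq, mul_pow, inv_pow]
  simp only [hterm]
  rw [← Finset.sum_div, Fin.sum_univ_eq_sum_range
    (fun x => (ζ ^ (y : ℕ) * (ζ ^ (z : ℕ))⁻¹) ^ x) (m + 1)]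
  by_cases h : y = z
  · subst h
    rw [mul_inv_cancel₀ (pow_ne_zero _ hζ0), Matrix.one_apply_eq]
    simp [hM]
  · have h1 : ζ ^ (y : ℕ) * (ζ ^ (z : ℕ))⁻¹ ≠ 1 := by
      intro h1
      rw [mul_inv_eq_one₀ (pow_ne_zero _ hζ0)] at h1
      exact h (Fin.ext (hprim.pow_inj y.2 z.2 h1))
    have h2 : (ζ ^ (y : ℕ) * (ζ ^ (z : ℕ))⁻¹) ^ (m + 1) = 1 := by
      rw [mul_pow, inv_pow, ← pow_mul, mul_comm (y : ℕ), pow_mul,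
        hprim.pow_eq_one, one_pow, ← pow_mul, mul_comm (z : ℕ), pow_mul, hprim.pow_eq_one, one_pow,
        inv_one, mul_one]
    rw [geom_sum_eq h1, h2, Matrix.one_apply_ne h]
    simp

def qft (m : ℕ) : Matrix.unitaryGroup (Fin (m + 1)) ℂ := ⟨qftMatrix m, qftMatrix_mem m⟩

end Unitary

/-! ### Circuits that use a walk operator as a black box, and their step count -/

section Programs

variable {X A : Type} [Fintype X] [DecidableEq X] [Fintype A] [DecidableEq A]

/-- A gate on the walk space `X` together with ancilla registers `A`: a fixed unitary,
or one step (or one inverse step) of the walk, controlled on the ancillas being in a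
basis state that satisfies `c`. -/
inductive Gate (X A : Type) [Fintype X] [DecidableEq X] [Fintype A] [DecidableEq A] : Type
  | free (U : Matrix.unitaryGroup (X × A) ℂ)
  | walk (c : A → Bool)
  | walkInv (c : A → Bool)

/-- The number of walk steps of a gate. -/
def Gate.steps : Gate X A → ℕ
  | .free _ => 0
  | .walk _ => 1
  | .walkInv _ => 1

/-- The action of a gate if the walk operator is `W`. -/
def Gate.eval (W : Matrix.unitaryGroup X ℂ) : Gate X A → Matrix.unitaryGroup (X × A) ℂ
  | .free U => U
  | .walk c => select fun a => if c a then W else 1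
  | .walkInv c => select fun a => if c a then W⁻¹ else 1

/-- Gates in the order in which they are applied. -/
abbrev Circuit (X A : Type) [Fintype X] [DecidableEq X] [Fintype A] [DecidableEq A] : Type :=
  List (Gate X A)

def Circuit.steps (c : Circuit X A) : ℕ := (c.map Gate.steps).sum

def Circuit.eval (W : Matrix.unitaryGroup X ℂ) : Circuit X A → Matrix.unitaryGroup (X × A) ℂ
  | [] => 1
  | g :: c => Circuit.eval W c * g.eval W

/-- The outcome distribution of a measurement of all registers in the computational basis
after `U` has been applied to the basis state `z₀`. -/
def measure {Z : Type} [Fintype Z] [DecidableEq Z] (U : Matrix.unitaryGroup Z ℂ) (z₀ : Z) :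
    PMF Z :=
  PMF.ofFintype (fun z => ENNReal.ofReal (‖(U : Matrix Z Z ℂ) z z₀‖ ^ 2)) (by
    rw [← ENNReal.ofReal_sum_of_nonneg (fun _ _ => by positivity), ← ENNReal.ofReal_one]
    congr 1
    have h := congrFun (congrFun (Matrix.mem_unitaryGroup_iff'.1 U.2) z₀) z₀
    rw [Matrix.mul_apply, Matrix.one_apply_eq] at h
    have h2 : ((∑ z, ‖(U : Matrix Z Z ℂ) z z₀‖ ^ 2 : ℝ) : ℂ) = 1 := by
      rw [← h]
      push_cast
      refine Finset.sum_congr rfl fun z _ => ?_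
      rw [Matrix.star_apply, RCLike.star_def, Complex.conj_mul']
    exact_mod_cast h2)

/-- A quantum algorithm with classical control: either return a value, or prepare a basis state,
run a circuit on it, measure, and continue depending on the outcome. The walk operator is not an
input: it enters only through the gates `walk` and `walkInv`. -/
inductive Prog (X : Type) [Fintype X] [DecidableEq X] (α : Type) : Type 1
  | ret (a : α) : Prog X α
  | run (A : Type) [Fintype A] [DecidableEq A] (c : Circuit X A) (z₀ : X × A)
      (k : X × A → Prog X α) : Prog X α

/-- The joint distribution of the output and of the total number of walk steps. -/
def Prog.exec {α : Type} (W : Matrix.unitaryGroup X ℂ) : Prog X α → PMF (α × ℕ)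
  | .ret a => PMF.pure (a, 0)
  | @Prog.run _ _ _ _ _ _ _ c z₀ k => (measure (Circuit.eval W c) z₀).bind fun z =>
      ((k z).exec W).map fun r => (r.1, Circuit.steps c + r.2)

/-- Sequential composition. -/
def Prog.bind {α β : Type} : Prog X α → (α → Prog X β) → Prog X β
  | .ret a, f => f a
  | @Prog.run _ _ _ _ A _ _ c z₀ k, f => .run A c z₀ fun z => (k z).bind f

/-- Run `p` independently `n` times and collect the outputs. -/
def Prog.iterate {α : Type} (p : Prog X α) : ℕ → Prog X (List α)
  | 0 => .ret []
  | n + 1 => p.bind fun a => (p.iterate n).bind fun l => .ret (a :: l)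

end Programs

/-! ### The random walk and the quantum walk on a graph -/

section Walk

variable {N : ℕ}

/-- The lazy symmetric random walk on a graph with degree bound `d`; `P v u` is the probability
of a jump from `u` to `v`. -/
def transition (G : SimpleGraph (Fin N)) [DecidableRel G.Adj] (d : ℕ) :
    Matrix (Fin N) (Fin N) ℝ := fun v u =>
  if G.Adj u v then 1 / (2 * d) else if v = u then 1 - (G.degree u : ℝ) / (2 * d) else 0

/-- The basis states `|i, j⟩` of the coined node space; `none` is the flat state. -/
abbrev Coined (N : ℕ) : Type := Fin N × Option (Fin N)

/-- A coin toss operator `∑ᵢ |i⟩⟨i| ⊗ Vᵢ` for the Markov chain `P`: unitaries `Vᵢ` that map the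
flat state to `∑ⱼ √(P j i) |j⟩`, completed arbitrarily. -/
structure CoinToss (P : Matrix (Fin N) (Fin N) ℝ) where
  toss : Fin N → Matrix.unitaryGroup (Option (Fin N)) ℂ
  toss_flat : ∀ i, (toss i : Matrix (Option (Fin N)) (Option (Fin N)) ℂ) none none = 0
  toss_node : ∀ i j, (toss i : Matrix (Option (Fin N)) (Option (Fin N)) ℂ) (some j) none
    = (Real.sqrt (P j i) : ℂ)

/-- Coin toss operators exist. -/
theorem CoinToss.nonempty (G : SimpleGraph (Fin N)) [DecidableRel G.Adj] {d : ℕ}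
    (hd : ∀ v, G.degree v ≤ d) : Nonempty (CoinToss (transition G d)) := by
  have hnn : ∀ i j, 0 ≤ transition G d j i := by
    intro i j
    rw [transition]
    split_ifs
    · positivity
    · have : (G.degree i : ℝ) ≤ d := by exact_mod_cast hd i
      rw [sub_nonneg]
      apply div_le_one_of_le₀ <;> [linarith [Nat.cast_nonneg (α := ℝ) d]; positivity]
    · exact le_rfl
  have hsum : ∀ i, ∑ j, transition G d j i = 1 := by
    intro i
    have e : ∀ j, transition G d j i = (if G.Adj i j then (1 : ℝ) / (2 * d) else 0)
        + (if j = i then 1 - (G.degree i : ℝ) / (2 * d) else 0) := by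
      intro j
      rw [transition]
      by_cases h : G.Adj i j
      · simp [h, h.ne']
      · simp [h]
    simp only [e, Finset.sum_add_distrib, Finset.sum_ite_eq', Finset.mem_univ, if_true]
    rw [← Finset.sum_filter, Finset.sum_const, ← SimpleGraph.neighborFinset_eq_filter,
      SimpleGraph.card_neighborFinset_eq_degree, nsmul_eq_mul]
    ring
  have hnorm : ∀ i, ∑ j, (Real.sqrt (transition G d j i)) ^ 2 = 1 := by
    intro i
    simp only [Real.sq_sqrt (hnn i _), hsum]
  refine ⟨⟨fun i => householder none fun x => x.elim 0 fun j => Real.sqrt (transition G d j i), fun i => ?_, fun i j => ?_⟩⟩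
  · simp [householder, householderMatrix, hnorm]
    norm_num
  · simp [householder, householderMatrix, hnorm]
    ring

/-- The coin toss operator `V` on the coined node space. -/
def CoinToss.unitary {P : Matrix (Fin N) (Fin N) ℝ} (V : CoinToss P) :
    Matrix.unitaryGroup (Coined N) ℂ :=
  relabel (Equiv.prodComm _ _) (select V.toss)

/-- The map `|i, j⟩ ↦ |j, i⟩` on edges `(i, j)`; all other basis states are fixed. -/
def shiftFun (G : SimpleGraph (Fin N)) [DecidableRel G.Adj] : Coined N → Coined N
  | (i, some j) => if G.Adj i j then (j, some i) else (i, some j)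
  | (i, none) => (i, none)

theorem shiftFun_involutive (G : SimpleGraph (Fin N)) [DecidableRel G.Adj] :
    Function.Involutive (shiftFun G) := by
  rintro ⟨i, _ | j⟩
  · rfl
  · by_cases h : G.Adj i j
    · simp [shiftFun, h, h.symm]
    · simp [shiftFun, h]

/-- The shift operator `S`. -/
def shift (G : SimpleGraph (Fin N)) [DecidableRel G.Adj] : Matrix.unitaryGroup (Coined N) ℂ :=
  permUnitary (shiftFun_involutive G).toPerm

/-- One step of the quantum walk: `W = R U` with `U = V† S V` and `R` the reflection
around the flat subspace. -/
def walkStep (G : SimpleGraph (Fin N)) [DecidableRel G.Adj] {P : Matrix (Fin N) (Fin N) ℝ}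
    (V : CoinToss P) : Matrix.unitaryGroup (Coined N) ℂ :=
  signFlip (fun z : Coined N => z.2 ≠ none) * (V.unitary⁻¹ * shift G * V.unitary)

/-- The Euclidean norm of the distribution `Pᵗ u` of the walk started in the node `u`. -/
def walkNorm (P : Matrix (Fin N) (Fin N) ℝ) (t : ℕ) (u : Fin N) : ℝ :=
  ‖(WithLp.toLp 2 ((P ^ t).mulVec (Pi.single u 1)) : EuclideanSpace ℝ (Fin N))‖

end Walk

/-! ### The algorithms -/

section Algorithms

variable {N : ℕ}

/-- The coefficients of the Chebyshev expansion `xᵗ = ∑ₗ pₗ Tₗ(x)`. -/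
def chebCoeff (t l : ℕ) : ℝ :=
  if l ≤ t ∧ l % 2 = t % 2 then
    (if l = 0 then 1 else 2) * (t.choose ((t - l) / 2) : ℝ) / 2 ^ t
  else 0

/-- The normalized coefficients of the expansion truncated at `τ`. -/
def truncCoeff (t τ l : ℕ) : ℝ := chebCoeff t l / (1 - ∑ j ∈ Finset.Ioc τ t, chebCoeff t j)

/-- The ancillas: the register of the linear combination, and the phase register. -/
abbrev Anc (τ m : ℕ) : Type := Fin (τ + 1) × Fin (m + 1)

/-- The unitary `V_q`, which maps `|0⟩` to `∑ₗ √qₗ |l⟩`, on the first ancilla. -/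
def prepare (N t τ m : ℕ) : Matrix.unitaryGroup (Coined N × Anc τ m) ℂ :=
  tensor 1 (tensor (householder 0 fun l => Real.sqrt (truncCoeff t τ l)) 1)

/-- The quantum Fourier transform on the phase register. -/
def phaseQft (N τ m : ℕ) : Matrix.unitaryGroup (Coined N × Anc τ m) ℂ :=
  tensor 1 (tensor 1 (qft m))

/-- The fast-forwarding operator `W_τ = V_q† (∑ₗ Wˡ ⊗ |l⟩⟨l|) V_q`. -/
def fastForward (N t τ m : ℕ) : Circuit (Coined N) (Anc τ m) :=
  .free (prepare N t τ m) ::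
    ((List.range τ).map fun i => .walk fun a => decide (i < (a.1 : ℕ))) ++
    [.free (prepare N t τ m)⁻¹]

/-- The inverse `W_τ† = V_q† (∑ₗ (W†)ˡ ⊗ |l⟩⟨l|) V_q`. -/
def fastForwardInv (N t τ m : ℕ) : Circuit (Coined N) (Anc τ m) :=
  .free (prepare N t τ m) ::
    ((List.range τ).map fun i => .walkInv fun a => decide (i < (a.1 : ℕ))) ++
    [.free (prepare N t τ m)⁻¹]

/-- The operator `-R_ψ R` with `ψ = W_τ |u, flat, 0⟩`, `R_ψ = W_τ R_u W_τ†` the reflection around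
`ψ`, and `R` the reflection around the flat subspace, controlled on the phase register
being in a state `|j⟩` with `j > i`. -/
def grover (t τ m : ℕ) (u : Fin N) (i : ℕ) : Circuit (Coined N) (Anc τ m) :=
  .free (signFlip fun z => i < (z.2.2 : ℕ) ∧ ¬ (z.1.2 = none ∧ z.2.1 = 0)) ::
    fastForwardInv N t τ m ++
    (.free (signFlip fun z => i < (z.2.2 : ℕ) ∧ z.1 = (u, none) ∧ z.2.1 = 0)) ::
    fastForward N t τ m

/-- The amplitude estimation circuit: prepare `ψ`, apply the Fourier transform to the phase
register, then `∑ⱼ (-R_ψ R)ʲ ⊗ |j⟩⟨j|`, then the inverse Fourier transform. -/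
def estimationCircuit (t τ m : ℕ) (u : Fin N) : Circuit (Coined N) (Anc τ m) :=
  fastForward N t τ m ++ .free (phaseQft N τ m) ::
    (List.range m).flatMap (grover t τ m u) ++ [.free (phaseQft N τ m)⁻¹]

/-- One run of amplitude estimation with `m` Grover iterations: on outcome `y` of the phase
register, the estimate is `sin (π y / (m + 1))`. -/
def estimateOnce (t τ m : ℕ) (u : Fin N) : Prog (Coined N) ℝ :=
  .run (Anc τ m) (estimationCircuit t τ m u) ((u, none), (0, 0)) fun z =>
    .ret (Real.sin (Real.pi * (z.2.2 : ℕ) / (m + 1)))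

open Classical in
/-- The first estimate `a` such that at least two thirds of the estimates lie in `[a, a + 2η]`
(0 if there is none). -/
def pick (η : ℝ) (l : List ℝ) : ℝ :=
  (l.find? fun a => decide
    (2 * l.length ≤ 3 * l.countP fun b => decide (a ≤ b ∧ b ≤ a + 2 * η))).getD 0

/-- Quantum amplitude estimation of the norm of the flat part of `W_τ |u, flat, 0⟩` to error `η`
with probability `1 - δ`: each of `⌈18 ln(1/δ)⌉` runs has error at most `η / 3` with
probability at least `5/6`. -/
def amplitudeEstimation (t τ : ℕ) (u : Fin N) (η δ : ℝ) : Prog (Coined N) ℝ :=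
  ((estimateOnce t τ ⌈4 * Real.pi / (η / 3)⌉₊ u).iterate ⌈18 * Real.log (1 / δ)⌉₊).bind
    fun l => .ret (pick (η / 3) l)

/-- The quantum 2-norm estimator, with additive error `ε` and confidence `δ`. -/
def normEstimator (t : ℕ) (u : Fin N) (ε δ : ℝ) : Prog (Coined N) ℝ :=
  amplitudeEstimation t ⌈Real.sqrt (2 * t * Real.log (8 * Real.sqrt N / ε))⌉₊ u (ε / 2) δ

open Classical in
/-- At most `n` iterations, numbered `k, k + 1, …`, of the loop of the multiplicative estimator;
`a` is the current estimate. -/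
def multLoop (t : ℕ) (u : Fin N) (ε δ' : ℝ) : ℕ → ℕ → ℝ → Prog (Coined N) ℝ
  | 0, _, a => .ret a
  | n + 1, k, _ => (normEstimator t u (ε * 2⁻¹ ^ (k + 2)) δ').bind fun a =>
      if a ≥ (1 + ε) * 2⁻¹ ^ k then .ret a else multLoop t u ε δ' n (k + 1) a

/-- The number `⌈(log₂ N) / 2⌉` of iterations of the multiplicative estimator. -/
def numIter (N : ℕ) : ℕ := ⌈Real.logb 2 N / 2⌉₊

/-- The quantum multiplicative 2-norm estimator, with relative error `ε` and confidence `δ`. -/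
def multNormEstimator (t : ℕ) (u : Fin N) (ε δ : ℝ) : Prog (Coined N) ℝ :=
  multLoop t u ε (δ / numIter N) (numIter N) 1 0

end Algorithms

end QFF

end

/-! Write `R` for the reflection around the flat subspace. The flat block of `V† S V` is `P`, and
`R` fixes the flat states and conjugates `W` into `W⁻¹`. Hence `W + W⁻¹` maps the flat subspace to
itself, where it acts as `2P` (`walkStep_add_inv_apply`). Expanding `(W + W⁻¹)ᵗ` by the binomial
theorem and grouping the exponents `2j - t` by absolute value writes `Pᵗu` as a convex combination
of the flat parts of `Wˡ|u,♭⟩`. The weights `p_l` are the law of `|S_t|` for a simple ±1 walk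
(`two_pow_mul_transition_pow`, `sum_choose_smul_natAbs`, `walkNorm_eq`). A Chernoff bound makes the
mass beyond `τ` small, so the flat part of `W_τ|u,♭,0⟩` has almost the norm of `Pᵗu`
(`sum_chebCoeff_tail_le`, `exists_flat_norm`).

Amplitude estimation is analysed without eigenvectors. The Grover operator `H` is a product of two
reflections, so `H + H⁻¹` acts on the start state as the scalar `2 cos φ`, with `φ = 2 arcsin a` and
`a` the norm to be found. Therefore the overlaps of the powers of `H` are cosines
(`grover_zpow_apply`), and the outcome law is the average of two phase estimation laws, for `φ` and
`-φ` (`sum_normSq_phase`). Each has tail at most `1/6` (`sum_phaseKernel_le`). Repetition with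
majority selection reduces the failure probability exponentially (`Prog.mean_pick_iterate_le`).

In the loop, an accurate estimate that passes the threshold in iteration `k` certifies `‖p‖ ≥ 2⁻ᵏ`,
so the additive error `ε2⁻ᵏ/4` is a relative one. If no threshold is passed, Cauchy–Schwarz gives
`‖p‖ ≥ 1/√N ≥ 2⁻ᵀ`, which serves the same purpose. A union bound gives the first claim
(`mean_multLoop_le`). Iteration `k` costs at most `B·2ᵏ`. While `2ᵏ‖p‖ < 4` these costs form a
geometric series of order `B/‖p‖`. Afterwards the loop goes on with probability at most `1/4` per
iteration, which outweighs the doubling of the cost (`cost_multLoop_le`,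
`cost_multLoop_le_of_four_le`). -/

noncomputable section

namespace QFF

open scoped ENNReal

/-! ### Expectations of programs -/

section Expectation

/-- The expectation of a nonnegative function. -/
def expect {α : Type} (p : PMF α) (f : α → ℝ≥0∞) : ℝ≥0∞ := ∑' a, p a * f a

variable {α β : Type}

theorem expect_pure (a : α) (f : α → ℝ≥0∞) : expect (PMF.pure a) f = f a := by
  rw [expect, tsum_eq_single a]
  · simp
  · intro b hb
    simp [PMF.pure_apply, hb]

theorem expect_bind (p : PMF α) (q : α → PMF β) (f : β → ℝ≥0∞) :
    expect (p.bind q) f = expect p fun a => expect (q a) f := by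
  simp only [expect, PMF.bind_apply, ← ENNReal.tsum_mul_right, ← ENNReal.tsum_mul_left]
  rw [ENNReal.tsum_comm]
  simp only [mul_assoc]

theorem expect_map (p : PMF α) (q : α → β) (f : β → ℝ≥0∞) :
    expect (p.map q) f = expect p fun a => f (q a) := by
  rw [← PMF.bind_pure_comp, expect_bind]
  simp only [Function.comp_apply, expect_pure]

theorem expect_const (p : PMF α) (c : ℝ≥0∞) : expect p (fun _ => c) = c := by
  rw [expect, ENNReal.tsum_mul_right, p.tsum_coe, one_mul]

theorem expect_add (p : PMF α) (f g : α → ℝ≥0∞) :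
    expect p (fun a => f a + g a) = expect p f + expect p g := by
  simp only [expect, mul_add, ENNReal.tsum_add]

theorem expect_mono (p : PMF α) {f g : α → ℝ≥0∞} (h : ∀ a, f a ≤ g a) :
    expect p f ≤ expect p g :=
  ENNReal.tsum_le_tsum fun a => mul_le_mul_right (h a) _

theorem expect_const_mul (p : PMF α) (c : ℝ≥0∞) (f : α → ℝ≥0∞) :
    expect p (fun a => c * f a) = c * expect p f := by
  rw [expect, expect, ← ENNReal.tsum_mul_left]
  exact tsum_congr fun a => by ring

variable {X : Type} [Fintype X] [DecidableEq X]

/-- The expectation of a function of the output of a program. -/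
def Prog.mean (W : Matrix.unitaryGroup X ℂ) (p : Prog X α) (g : α → ℝ≥0∞) : ℝ≥0∞ :=
  expect (p.exec W) fun r => g r.1

/-- The expected number of walk steps of a program. -/
def Prog.cost (W : Matrix.unitaryGroup X ℂ) (p : Prog X α) : ℝ≥0∞ :=
  expect (p.exec W) fun r => (r.2 : ℝ≥0∞)

/-- All possible outputs of a program satisfy `Q`. -/
def Prog.All (Q : α → Prop) : Prog X α → Prop
  | .ret a => Q a
  | @Prog.run _ _ _ _ _ _ _ _ _ k => ∀ z, (k z).All Q

variable (W : Matrix.unitaryGroup X ℂ)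

theorem Prog.mean_ret (a : α) (g : α → ℝ≥0∞) : (Prog.ret a : Prog X α).mean W g = g a := by
  rw [mean, exec, expect_pure]

theorem Prog.cost_ret (a : α) : (Prog.ret a : Prog X α).cost W = 0 := by
  rw [cost, exec, expect_pure, Nat.cast_zero]

variable {A : Type} [Fintype A] [DecidableEq A]

theorem Prog.mean_run (c : Circuit X A) (z₀ : X × A) (k : X × A → Prog X α) (g : α → ℝ≥0∞) :
    (Prog.run A c z₀ k).mean W g
      = expect (measure (Circuit.eval W c) z₀) fun z => (k z).mean W g := by
  simp only [mean, exec, expect_bind, expect_map]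

theorem Prog.cost_run (c : Circuit X A) (z₀ : X × A) (k : X × A → Prog X α) :
    (Prog.run A c z₀ k).cost W
      = Circuit.steps c + expect (measure (Circuit.eval W c) z₀) fun z => (k z).cost W := by
  simp only [cost, exec, expect_bind, expect_map, Nat.cast_add, expect_add, expect_const]

theorem Prog.mean_bind (p : Prog X α) (f : α → Prog X β) (g : β → ℝ≥0∞) :
    (p.bind f).mean W g = p.mean W fun a => (f a).mean W g := by
  induction p with
  | ret a => rw [mean_ret, Prog.bind]
  | run A c z₀ k ih => simp only [Prog.bind, mean_run, ih]

theorem Prog.mean_mono {p : Prog X α} {g h : α → ℝ≥0∞} (hgh : ∀ a, g a ≤ h a) :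
    p.mean W g ≤ p.mean W h :=
  expect_mono _ fun _ => hgh _

/-- Used where a comparison holds only for attainable outputs: lists of the right length, estimates
in `[0, 1]`. -/
theorem Prog.mean_mono_of_all {p : Prog X α} {Q : α → Prop} (hp : p.All Q) {g h : α → ℝ≥0∞}
    (hgh : ∀ a, Q a → g a ≤ h a) : p.mean W g ≤ p.mean W h := by
  induction p with
  | ret a => rw [mean_ret, mean_ret]; exact hgh a hp
  | run A c z₀ k ih =>
    rw [mean_run, mean_run]
    exact expect_mono _ fun z => ih z (hp z)

theorem Prog.mean_const (p : Prog X α) (c : ℝ≥0∞) : p.mean W (fun _ => c) = c :=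
  expect_const _ _

theorem Prog.mean_add (p : Prog X α) (f g : α → ℝ≥0∞) :
    p.mean W (fun a => f a + g a) = p.mean W f + p.mean W g :=
  expect_add _ _ _

theorem Prog.mean_const_mul (p : Prog X α) (c : ℝ≥0∞) (f : α → ℝ≥0∞) :
    p.mean W (fun a => c * f a) = c * p.mean W f :=
  expect_const_mul _ _ _

theorem Prog.cost_bind (p : Prog X α) (f : α → Prog X β) :
    (p.bind f).cost W = p.cost W + p.mean W fun a => (f a).cost W := by
  induction p with
  | ret a => rw [mean_ret, cost_ret, Prog.bind, zero_add]
  | run A c z₀ k ih => simp only [Prog.bind, mean_run, cost_run, ih, expect_add, add_assoc]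

theorem Prog.cost_bind_ret (p : Prog X α) (f : α → β) :
    (p.bind fun a => .ret (f a)).cost W = p.cost W := by
  simp only [cost_bind, cost_ret, mean_const, add_zero]

theorem Prog.all_bind {p : Prog X α} {f : α → Prog X β} {Q : α → Prop} {R : β → Prop}
    (hp : p.All Q) (hf : ∀ a, Q a → (f a).All R) : (p.bind f).All R := by
  induction p with
  | ret a => exact hf a hp
  | run A c z₀ k ih => exact fun z => ih z (hp z)

theorem Prog.all_iterate {p : Prog X α} {Q : α → Prop} (hp : p.All Q) (n : ℕ) :
    (p.iterate n).All fun l => l.length = n ∧ ∀ a ∈ l, Q a := by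
  induction n with
  | zero => simp [iterate, All]
  | succ n ih =>
    refine all_bind hp fun a ha => all_bind ih fun l hl => ⟨by simp [hl.1], fun b hb => ?_⟩
    rcases List.mem_cons.1 hb with rfl | hb
    exacts [ha, hl.2 b hb]

theorem Prog.cost_iterate (p : Prog X α) (n : ℕ) : (p.iterate n).cost W = n * p.cost W := by
  induction n with
  | zero => simp [iterate, cost_ret]
  | succ n ih =>
    simp only [iterate, cost_bind, cost_ret, mean_const, ih, add_zero]
    push_cast
    ring

/-- Independence of the runs, in the multiplicative form that a Chernoff bound needs. -/
theorem Prog.mean_iterate (p : Prog X α) (g : α → ℝ≥0∞) (n : ℕ) :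
    (p.iterate n).mean W (fun l => (l.map g).prod) = p.mean W g ^ n := by
  induction n with
  | zero => simp [iterate, mean_ret]
  | succ n ih =>
    simp only [iterate, mean_bind, mean_ret, List.map_cons, List.prod_cons, mean_const_mul, ih]
    simp only [mul_comm _ (p.mean W g ^ n), mean_const_mul]
    rw [pow_succ]

theorem Prog.mean_indicator (p : Prog X α) (s : Set α) :
    p.mean W (s.indicator 1) = (p.exec W).toOuterMeasure {r | r.1 ∈ s} := by
  rw [mean, expect, PMF.toOuterMeasure_apply]
  refine tsum_congr fun r => ?_
  by_cases h : r.1 ∈ s <;> simp [Set.indicator, h]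

theorem Prog.le_toOuterMeasure_of_mean_compl_le (p : Prog X α) (s : Set α) {δ : ℝ} (hδ : 0 ≤ δ)
    (h : p.mean W (sᶜ.indicator 1) ≤ ENNReal.ofReal δ) :
    ENNReal.ofReal (1 - δ) ≤ (p.exec W).toOuterMeasure {r | r.1 ∈ s} := by
  rw [← mean_indicator, ENNReal.ofReal_sub _ hδ, ENNReal.ofReal_one, tsub_le_iff_right]
  calc (1 : ℝ≥0∞) = p.mean W (fun _ => 1) := (mean_const W p 1).symm
    _ = p.mean W (fun a => s.indicator 1 a + sᶜ.indicator 1 a) := by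
      congr 1
      funext a
      by_cases h : a ∈ s <;> simp [h]
    _ ≤ _ := by
      rw [mean_add]
      gcongr

end Expectation

/-! ### Selecting an estimate -/

section Pick

theorem pick_mem (η : ℝ) (l : List ℝ) : pick η l = 0 ∨ pick η l ∈ l := by
  rw [pick]
  rcases h : l.find? _ with _ | a
  · exact Or.inl rfl
  · exact Or.inr (List.mem_of_find?_eq_some h)

theorem exists_of_length_lt_countP_add {α : Type} (l : List α) (p q : α → Bool)
    (h : l.length < l.countP p + l.countP q) : ∃ a ∈ l, p a ∧ q a := by
  by_contra! hc
  have : l.countP q ≤ l.countP (fun a => ! p a) := by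
    refine List.countP_mono_left fun a ha hq => ?_
    have := hc a ha
    cases hp : p a <;> simp_all
  have h2 := l.length_eq_countP_add_countP (p := p)
  have h3 : l.countP (fun a => ! p a) = l.countP (fun a => decide ¬ p a = true) := by
    congr 1
    funext a
    simp
  omega

/-- If two thirds of the estimates have error at most `η`, the selected one has error at
most `3η`. -/
theorem abs_pick_sub_le {η x : ℝ} {l : List ℝ} (hl : l ≠ [])
    (h : 2 * l.length ≤ 3 * l.countP fun a => decide (|a - x| ≤ η)) :
    |pick η l - x| ≤ 3 * η := by
  classical
  have hpos : 0 < l.length := List.length_pos_of_ne_nil hl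
  set good : ℝ → Bool := fun a => decide (|a - x| ≤ η)
  set win : ℝ → ℝ → Bool := fun a b => decide (a ≤ b ∧ b ≤ a + 2 * η)
  -- The smallest estimate within `η` of `x` is a witness: every other such estimate lies at most
  -- `2η` above it.
  have hex : ∃ a ∈ l, 2 * l.length ≤ 3 * l.countP (win a) := by
    have hne : (l.toFinset.filter fun a => good a).Nonempty := by
      have : 0 < l.countP good := by omega
      obtain ⟨a, ha, hg⟩ := List.countP_pos_iff.1 this
      exact ⟨a, by simp [ha, hg]⟩
    obtain ⟨a, ha, hmin⟩ := Finset.exists_min_image _ id hne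
    simp only [Finset.mem_filter, List.mem_toFinset, id] at ha hmin
    refine ⟨a, ha.1, h.trans (Nat.mul_le_mul_left 3 (List.countP_mono_left fun b hb hg => ?_))⟩
    have h1 := hmin b ⟨hb, hg⟩
    simp only [good, decide_eq_true_eq, abs_le] at hg ha
    simp only [win, decide_eq_true_eq]
    constructor <;> linarith [hg.1, hg.2, ha.2.1, ha.2.2]
  have hpick : 2 * l.length ≤ 3 * l.countP (win (pick η l)) := by
    rcases hf : l.find? (fun a => decide (2 * l.length ≤ 3 * l.countP (win a))) with _ | a
    · obtain ⟨a, ha, h2⟩ := hex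
      have := List.find?_eq_none.1 hf a ha
      simp only [decide_eq_true_eq] at this
      exact absurd h2 this
    · have h3 : pick η l = a := by
        rw [pick]
        have : l.find? (fun a => decide
            (2 * l.length ≤ 3 * l.countP fun b => decide (a ≤ b ∧ b ≤ a + 2 * η))) = some a := by
          convert hf using 3
        convert congrArg (fun o => o.getD 0) this using 4
        rfl
      rw [h3]
      simpa using List.find?_some hf
  -- Two sets of at least two thirds of the estimates share a member `b`, by pigeonhole. From `|b -
  -- x| ≤ η` and `pick ≤ b ≤ pick + 2η` the bound follows.
  obtain ⟨b, -, hg, hw⟩ := exists_of_length_lt_countP_add l good (win (pick η l)) (by omega)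
  simp only [good, win, decide_eq_true_eq, abs_le] at hg hw
  rw [abs_le]
  constructor <;> linarith [hg.1, hg.2, hw.1, hw.2]

/-- Amplification: if a program has error more than `η` with probability at most `1/6`, then
selecting among `n` runs has error more than `3η` with probability at most `exp (-n/18)`. -/
theorem Prog.mean_pick_iterate_le {X : Type} [Fintype X] [DecidableEq X]
    (W : Matrix.unitaryGroup X ℂ) (p : Prog X ℝ) {η x : ℝ}
    (hp : p.mean W ({a | |a - x| ≤ η}ᶜ.indicator 1) ≤ ENNReal.ofReal (1 / 6)) {n : ℕ}
    (hn : n ≠ 0) :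
    ((p.iterate n).bind fun l => .ret (pick η l)).mean W ({a | |a - x| ≤ 3 * η}ᶜ.indicator 1)
      ≤ ENNReal.ofReal (Real.exp (-(n / 18))) := by
  classical
  -- The weight is 2 for a bad run and 1 for a good one. Failure needs more than `n/3` bad runs,
  -- hence a product of at least `2^(n/3)`; Markov's inequality then applies to the product.
  set g : ℝ → ℝ≥0∞ := fun a => 1 + {a | |a - x| ≤ η}ᶜ.indicator 1 a with hg
  have hgmean : p.mean W g ≤ ENNReal.ofReal (7 / 6) := by
    rw [hg, mean_add, mean_const]
    calc _ ≤ 1 + ENNReal.ofReal (1 / 6) := by gcongr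
      _ = _ := by rw [← ENNReal.ofReal_one, ← ENNReal.ofReal_add] <;> norm_num
  have hprod : ∀ l : List ℝ, (l.map g).prod
      = ENNReal.ofReal (2 ^ (l.length - l.countP fun a => decide (|a - x| ≤ η))) := by
    intro l
    induction l with
    | nil => simp
    | cons a l ih =>
      have hle : l.countP (fun a => decide (|a - x| ≤ η)) ≤ l.length := List.countP_le_length
      rw [List.map_cons, List.prod_cons, ih, List.countP_cons, List.length_cons]
      by_cases h : |a - x| ≤ η
      · simp [hg, h]
      · have : g a = ENNReal.ofReal 2 := by
          simp only [hg, Set.indicator, Set.mem_compl_iff, Set.mem_ofPred_eq, h, not_false_eq_true,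
            if_true, Pi.one_apply, one_add_one_eq_two, ENNReal.ofReal_ofNat]
        rw [this, ← ENNReal.ofReal_mul (by norm_num), ← pow_succ']
        simp only [h, decide_false, Bool.false_eq_true, if_false, add_zero]
        congr 2
        omega
  set c : ℝ := (2 : ℝ) ^ (-(n / 3 : ℝ)) with hc
  have hc0 : 0 < c := by positivity
  simp only [mean_bind, mean_ret]
  calc (p.iterate n).mean W (fun l => {a | |a - x| ≤ 3 * η}ᶜ.indicator 1 (pick η l))
      ≤ (p.iterate n).mean W (fun l => ENNReal.ofReal c * (l.map g).prod) := by
        refine mean_mono_of_all W (all_iterate (Q := fun _ => True) (p := p) ?_ n) fun l hl => ?_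
        · clear hp hgmean
          induction p with
          | ret a => trivial
          | run A c z₀ k ih => exact fun z => ih z
        · by_cases h : |pick η l - x| ≤ 3 * η
          · simp [h]
          · have hlt : 3 * l.countP (fun a => decide (|a - x| ≤ η)) < 2 * l.length := by
              by_contra! hcon
              exact h (abs_pick_sub_le (by rintro rfl; simp at hl; omega) hcon)
            simp only [Set.indicator, Set.mem_compl_iff, Set.mem_ofPred_eq, h, not_false_eq_true,
              if_true, Pi.one_apply]
            rw [hprod, ← ENNReal.ofReal_mul hc0.le, ← ENNReal.ofReal_one]
            apply ENNReal.ofReal_le_ofReal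
            rw [hc, ← Real.rpow_natCast, ← Real.rpow_add (by norm_num)]
            apply Real.one_le_rpow (by norm_num)
            have h5 : n ≤ 3 * (l.length - l.countP fun a => decide (|a - x| ≤ η)) := by
              have := hl.1
              omega
            have h6 : (n : ℝ) ≤ 3 * ((l.length - l.countP fun a => decide (|a - x| ≤ η) : ℕ) : ℝ) := by
              exact_mod_cast h5
            linarith
    _ ≤ ENNReal.ofReal c * ENNReal.ofReal (7 / 6) ^ n := by
        rw [mean_const_mul, mean_iterate]
        gcongr
    _ ≤ _ := by
        rw [← ENNReal.ofReal_pow (by norm_num), ← ENNReal.ofReal_mul hc0.le]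
        apply ENNReal.ofReal_le_ofReal
        -- Cubing removes the fractional exponent. What is left is `(7/6)³/2 = 343/432 ≤ 5/6 ≤
        -- exp(-1/6)`.
        have h1 : (c * (7 / 6) ^ n) ^ 3 = ((7 / 6 : ℝ) ^ 3 / 2) ^ n := by
          rw [mul_pow, hc, ← Real.rpow_natCast, ← Real.rpow_mul (by norm_num)]
          have : (-(n / 3 : ℝ) * (3 : ℕ)) = -(n : ℝ) := by push_cast; ring
          rw [this, Real.rpow_neg (by norm_num), Real.rpow_natCast, ← pow_mul,
            mul_comm n 3, pow_mul, inv_mul_eq_div, ← div_pow]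
        have h2 : Real.exp (-(n / 18)) ^ 3 = Real.exp (-(1 / 6)) ^ n := by
          rw [← Real.exp_nat_mul, ← Real.exp_nat_mul]
          congr 1
          push_cast
          ring
        refine le_of_pow_le_pow_left₀ (n := 3) (by norm_num) (Real.exp_pos _).le ?_
        rw [h1, h2]
        have := Real.add_one_le_exp (-(1 / 6 : ℝ))
        gcongr
        linarith

end Pick

/-! ### Phase estimation -/

section PhaseEstimation

/-- The probability that phase estimation with a register of dimension `M` returns an outcome
at distance `x` (in units of `1 / M`) from the phase. -/
def phaseKernel (M : ℕ) (x : ℝ) : ℝ :=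
  ‖∑ j ∈ Finset.range M, Complex.exp (Complex.I * (2 * Real.pi * x / M : ℝ)) ^ j‖ ^ 2 / M ^ 2

theorem phaseKernel_add_int_mul {M : ℕ} (hM : M ≠ 0) (x : ℝ) (k : ℤ) :
    phaseKernel M (x + M * k) = phaseKernel M x := by
  have hM' : (M : ℂ) ≠ 0 := by exact_mod_cast hM
  have : Complex.exp (Complex.I * (2 * Real.pi * (x + M * k) / M : ℝ))
      = Complex.exp (Complex.I * (2 * Real.pi * x / M : ℝ)) := by
    rw [Complex.exp_eq_exp_iff_exists_int]
    refine ⟨k, ?_⟩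
    push_cast
    field_simp
  rw [phaseKernel, this, phaseKernel]

/-- The geometric sum is `(z^M - 1)/(z - 1)`. Its numerator is at most 2, and Jordan's inequality
`|sin θ| ≥ 2|θ|/π` gives `|z - 1| ≥ 4|x|/M`. -/
theorem phaseKernel_le {M : ℕ} {x : ℝ} (hx : x ≠ 0) (hxM : |x| ≤ M / 2) :
    phaseKernel M x ≤ 1 / 4 * (1 / x ^ 2) := by
  have hM : (0 : ℝ) < M := by
    have := abs_pos.2 hx
    linarith
  have hx0 := abs_pos.2 hx
  set z := Complex.exp (Complex.I * (2 * Real.pi * x / M : ℝ)) with hz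
  have hz1 : 4 * |x| / M ≤ ‖z - 1‖ := by
    rw [hz, Complex.norm_exp_I_mul_ofReal_sub_one]
    have harg : |2 * Real.pi * x / M / 2| = Real.pi * (|x| / M) := by
      rw [show 2 * Real.pi * x / M / 2 = Real.pi * (x / M) by ring, abs_mul, abs_div,
        abs_of_pos Real.pi_pos, abs_of_pos hM]
    have h1 := Real.mul_abs_le_abs_sin (x := 2 * Real.pi * x / M / 2) (by
      rw [harg]
      have : |x| / M ≤ 1 / 2 := by rw [div_le_iff₀ hM]; linarith
      nlinarith [Real.pi_pos])
    rw [harg] at h1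
    rw [Real.norm_eq_abs, abs_mul, abs_two]
    have h2 : 2 / Real.pi * (Real.pi * (|x| / M)) = 2 * |x| / M := by
      field_simp
    rw [h2] at h1
    calc 4 * |x| / M = 2 * (2 * |x| / M) := by ring
      _ ≤ _ := by gcongr
  have hpos : 0 < 4 * |x| / M := by positivity
  have hne : z ≠ 1 := by
    rintro h
    rw [h, sub_self, norm_zero] at hz1
    linarith
  have hnz : ‖z‖ = 1 := by rw [hz, mul_comm, Complex.norm_exp_ofReal_mul_I]
  have hsum : ‖∑ j ∈ Finset.range M, z ^ j‖ ≤ M / (2 * |x|) := by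
    rw [geom_sum_eq hne, norm_div]
    have h2 : ‖z ^ M - 1‖ ≤ 2 := by
      refine (norm_sub_le _ _).trans ?_
      rw [norm_pow, hnz, one_pow, norm_one]
      norm_num
    calc _ ≤ 2 / (4 * |x| / M) := by gcongr
      _ = _ := by field_simp; norm_num
  rw [phaseKernel]
  calc _ ≤ (M / (2 * |x|)) ^ 2 / (M : ℝ) ^ 2 := by gcongr
    _ = _ := by
      rw [div_pow, mul_pow, sq_abs]
      field_simp
      norm_num

/-- Telescoping, by `1/n² ≤ 1/(n-1) - 1/n`. -/
theorem sum_one_div_sq_le (S : Finset ℕ) (hS : ∀ n ∈ S, 4 ≤ n) :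
    ∑ n ∈ S, 1 / (n : ℝ) ^ 2 ≤ 1 / 3 := by
  obtain ⟨K, hK⟩ : ∃ K, S ⊆ Finset.Ico 4 (4 + K) := by
    obtain ⟨b, hb⟩ := S.bddAbove
    exact ⟨b + 1, fun n hn => Finset.mem_Ico.2 ⟨hS n hn, by have := hb hn; omega⟩⟩
  have tele : ∀ K : ℕ, ∑ n ∈ Finset.Ico 4 (4 + K), 1 / (n : ℝ) ^ 2 ≤ 1 / 3 - 1 / ((K : ℝ) + 3) := by
    intro K
    induction K with
    | zero => simp
    | succ K ih =>
      rw [← add_assoc, Finset.sum_Ico_succ_top (by omega)]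
      have : 1 / (((4 + K : ℕ) : ℝ)) ^ 2 ≤ 1 / ((K : ℝ) + 3) - 1 / (K + 4) := by
        rw [div_sub_div _ _ (by positivity) (by positivity), div_le_div_iff₀ (by positivity)
          (by positivity)]
        push_cast
        nlinarith
      push_cast at this ⊢
      rw [show (K : ℝ) + 1 + 3 = K + 4 by ring]
      linarith
  calc _ ≤ ∑ n ∈ Finset.Ico 4 (4 + K), 1 / (n : ℝ) ^ 2 :=
        Finset.sum_le_sum_of_subset_of_nonneg hK fun _ _ _ => by positivity
    _ ≤ _ := (tele K).trans (by
      have : (0 : ℝ) ≤ 1 / ((K : ℝ) + 3) := by positivity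
      linarith)

/-- Replacing `l - s` by the smaller integer `l - ⌊s⌋ - 1 ≥ 4` increases each term and keeps
distinct `l` distinct. -/
theorem sum_one_div_int_sub_sq_le (S : Finset ℤ) (s : ℝ) (hS : ∀ l ∈ S, 4 < l - s) :
    ∑ l ∈ S, 1 / ((l : ℝ) - s) ^ 2 ≤ 1 / 3 := by
  have hfl : ∀ l ∈ S, 4 ≤ l - ⌊s⌋ - 1 := by
    intro l hl
    have h1 : s < ((l - 4 : ℤ) : ℝ) := by
      push_cast
      linarith [hS l hl]
    have := Int.floor_lt.2 h1
    omega
  have hinj : Set.InjOn (fun l : ℤ => (l - ⌊s⌋ - 1).toNat) S := by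
    intro a ha b hb h
    have h1 := hfl a ha
    have h2 := hfl b hb
    simp only at h
    omega
  calc _ ≤ ∑ l ∈ S, 1 / (((l - ⌊s⌋ - 1).toNat : ℕ) : ℝ) ^ 2 := by
        refine Finset.sum_le_sum fun l hl => ?_
        have h1 := hfl l hl
        have h2 : (((l - ⌊s⌋ - 1).toNat : ℕ) : ℝ) = l - ⌊s⌋ - 1 := by
          have : (((l - ⌊s⌋ - 1).toNat : ℕ) : ℤ) = l - ⌊s⌋ - 1 := Int.toNat_of_nonneg (by omega)
          exact_mod_cast congrArg (fun z : ℤ => (z : ℝ)) this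
        have h3 : (4 : ℝ) ≤ l - ⌊s⌋ - 1 := by exact_mod_cast h1
        rw [h2]
        have := Int.lt_floor_add_one s
        exact one_div_le_one_div_of_le (by positivity)
          (pow_le_pow_left₀ (by linarith) (by linarith) 2)
    _ = ∑ n ∈ S.image fun l : ℤ => (l - ⌊s⌋ - 1).toNat, 1 / (n : ℝ) ^ 2 := by
        rw [Finset.sum_image hinj]
    _ ≤ 1 / 3 := by
        refine sum_one_div_sq_le _ fun n hn => ?_
        obtain ⟨l, hl, rfl⟩ := Finset.mem_image.1 hn
        have := hfl l hl
        omega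

/-- The estimate `sin (π y / M)` obtained from the phase `s / M` has error more than `4π / M` with
probability at most `1/6`. -/
theorem sum_phaseKernel_le {M : ℕ} (hM : M ≠ 0) (s : ℝ) :
    ∑ y : Fin M, (if |Real.sin (Real.pi * (y : ℕ) / M) - (|Real.sin (Real.pi * s / M)|)|
      ≤ 4 * Real.pi / M then 0 else phaseKernel M (s - (y : ℕ))) ≤ 1 / 6 := by
  have hM0 : (0 : ℝ) < M := by exact_mod_cast Nat.pos_of_ne_zero hM
  -- The kernel has period `M`, so each outcome `y` may be moved by a multiple of `M` to the
  -- representative `l y` within `M/2` of `s`, where `phaseKernel_le` applies.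
  set r : Fin M → ℤ := fun y => round ((s - (y : ℕ)) / M) with hr
  set l : Fin M → ℤ := fun y => (y : ℕ) + M * r y with hl
  have hlval : ∀ y : Fin M, (l y : ℝ) = (y : ℕ) + M * r y := fun y => by simp [hl]
  have hinj : Function.Injective l := by
    intro a b h
    have h1 : (l a) % M = (l b) % M := by rw [h]
    simp only [hl, Int.add_mul_emod_self_left] at h1
    have ha := Int.emod_eq_of_lt (Int.natCast_nonneg (a : ℕ)) (Int.ofNat_lt.2 a.2)
    have hb := Int.emod_eq_of_lt (Int.natCast_nonneg (b : ℕ)) (Int.ofNat_lt.2 b.2)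
    rw [ha, hb] at h1
    exact Fin.ext (by exact_mod_cast h1)
  have hnear : ∀ y : Fin M, |s - l y| ≤ M / 2 := by
    intro y
    have h1 := abs_sub_round ((s - (y : ℕ)) / M)
    have h2 : s - l y = M * ((s - (y : ℕ)) / M - round ((s - (y : ℕ)) / M)) := by
      rw [hlval]
      field_simp
      ring
    rw [h2, abs_mul, abs_of_pos hM0]
    nlinarith
  have hker : ∀ y : Fin M, phaseKernel M (s - (y : ℕ)) = phaseKernel M (s - l y) := by
    intro y
    rw [← phaseKernel_add_int_mul hM (s - l y) (r y), hlval]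
    congr 1
    ring
  -- A shift of `y` by `M` leaves `|sin(πy/M)|` unchanged, and the sine is 1-Lipschitz, so distance
  -- at most 4 in `y` gives error at most `4π/M`.
  have hbad : ∀ y : Fin M, ¬ |Real.sin (Real.pi * (y : ℕ) / M) - (|Real.sin (Real.pi * s / M)|)|
      ≤ 4 * Real.pi / M → 4 < |s - l y| := by
    intro y hy
    by_contra! hcon
    apply hy
    have h0 : 0 ≤ Real.sin (Real.pi * (y : ℕ) / M) := by
      apply Real.sin_nonneg_of_nonneg_of_le_pi (by positivity)
      rw [div_le_iff₀ hM0]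
      have : ((y : ℕ) : ℝ) ≤ M := by exact_mod_cast y.2.le
      nlinarith [Real.pi_pos]
    have h1 : Real.sin (Real.pi * (y : ℕ) / M) = |Real.sin (Real.pi * l y / M)| := by
      have : Real.pi * l y / M = Real.pi * (y : ℕ) / M + r y * Real.pi := by
        rw [hlval]
        field_simp
      rw [this, Real.sin_add_int_mul_pi, abs_mul, abs_zpow, abs_neg, abs_one, one_zpow, one_mul,
        abs_of_nonneg h0]
    rw [h1]
    refine (abs_abs_sub_abs_le_abs_sub _ _).trans ?_
    have h2 : |Real.sin (Real.pi * l y / M) - Real.sin (Real.pi * s / M)|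
        ≤ |Real.pi * l y / M - Real.pi * s / M| := by
      have := Real.lipschitzWith_sin.dist_le_mul (Real.pi * l y / M) (Real.pi * s / M)
      simpa [Real.dist_eq] using this
    refine h2.trans ?_
    rw [show Real.pi * l y / M - Real.pi * s / M = Real.pi / M * (-(s - l y)) by ring, abs_mul,
      abs_neg, abs_of_pos (by positivity)]
    calc _ ≤ Real.pi / M * 4 := by gcongr
      _ = _ := by ring
  -- Two tails, each of mass at most `1/4 · 1/3 = 1/12`.
  set Sp := Finset.univ.filter fun y : Fin M => 4 < (l y : ℝ) - s with hSp
  set Sm := Finset.univ.filter fun y : Fin M => 4 < s - (l y : ℝ) with hSm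
  have hterm : ∀ y : Fin M, (if |Real.sin (Real.pi * (y : ℕ) / M) -
      (|Real.sin (Real.pi * s / M)|)| ≤ 4 * Real.pi / M then 0 else phaseKernel M (s - (y : ℕ)))
      ≤ (if 4 < (l y : ℝ) - s then 1 / 4 * (1 / ((l y : ℝ) - s) ^ 2) else 0)
        + (if 4 < s - (l y : ℝ) then 1 / 4 * (1 / ((l y : ℝ) - s) ^ 2) else 0) := by
    intro y
    split_ifs with h1 h2 h3 h3 h2 h3 h3
    any_goals positivity
    · linarith
    · rw [hker, add_zero]
      refine (phaseKernel_le (by intro h; linarith) (hnear y)).trans_eq ?_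
      congr 2
      ring
    · rw [hker, zero_add]
      refine (phaseKernel_le (by intro h; linarith) (hnear y)).trans_eq ?_
      congr 2
      ring
    · rcases lt_abs.1 (hbad y h1) with h | h
      · exact absurd h h3
      · exact absurd (by linarith) h2
  refine (Finset.sum_le_sum fun y _ => hterm y).trans ?_
  rw [Finset.sum_add_distrib, ← Finset.sum_filter, ← Finset.sum_filter, ← Finset.mul_sum,
    ← Finset.mul_sum]
  have hp : ∑ y ∈ Sp, 1 / ((l y : ℝ) - s) ^ 2 ≤ 1 / 3 := by
    rw [← Finset.sum_image (f := fun k : ℤ => 1 / ((k : ℝ) - s) ^ 2) hinj.injOn]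
    refine sum_one_div_int_sub_sq_le _ s fun k hk => ?_
    obtain ⟨y, hy, rfl⟩ := Finset.mem_image.1 hk
    exact (Finset.mem_filter.1 hy).2
  have hm : ∑ y ∈ Sm, 1 / ((l y : ℝ) - s) ^ 2 ≤ 1 / 3 := by
    have : ∑ y ∈ Sm, 1 / ((l y : ℝ) - s) ^ 2
        = ∑ y ∈ Sm, 1 / (((- l y : ℤ) : ℝ) - (-s)) ^ 2 := by
      refine Finset.sum_congr rfl fun y _ => ?_
      push_cast
      congr 1
      ring
    rw [this, ← Finset.sum_image (f := fun k : ℤ => 1 / ((k : ℝ) - (-s)) ^ 2) (g := fun y => - l y)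
      (fun a _ b _ h => hinj (neg_injective h))]
    refine sum_one_div_int_sub_sq_le _ (-s) fun k hk => ?_
    obtain ⟨y, hy, rfl⟩ := Finset.mem_image.1 hk
    have := (Finset.mem_filter.1 hy).2
    push_cast
    linarith
  linarith

variable {Y : Type} [Fintype Y] [DecidableEq Y]

open Matrix in
/-- If `H + H⁻¹` acts on the basis state `z` as `2 cos φ`, then the diagonal entries of the powers
of `H` at `z` are `cos (n φ)`. -/
theorem zpow_apply_of_add_inv {H : unitaryGroup Y ℂ} {z : Y} {φ : ℝ}
    (h1 : (H : Matrix Y Y ℂ) z z = Real.cos φ)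
    (h2 : (H⁻¹ : unitaryGroup Y ℂ).1 z z = Real.cos φ)
    (h : ∀ x, (H : Matrix Y Y ℂ) x z + (H⁻¹ : unitaryGroup Y ℂ).1 x z
      = if x = z then 2 * (Real.cos φ : ℂ) else 0) (n : ℤ) :
    (H ^ n : unitaryGroup Y ℂ).1 z z = Real.cos (n * φ) := by
  -- The three-term recurrence of `cos(nφ)`. It is solved below in both directions at once, carrying
  -- two consecutive exponents.
  have hrec : ∀ n : ℤ, (H ^ (n + 1) : unitaryGroup Y ℂ).1 z z
      + (H ^ (n - 1) : unitaryGroup Y ℂ).1 z z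
      = 2 * Real.cos φ * (H ^ n : unitaryGroup Y ℂ).1 z z := by
    intro n
    rw [_root_.zpow_add_one, _root_.zpow_sub_one, Submonoid.coe_mul, Submonoid.coe_mul, mul_apply, mul_apply,
      ← Finset.sum_add_distrib]
    simp only [← mul_add, h, mul_ite, mul_zero, Finset.sum_ite_eq', Finset.mem_univ, if_true]
    ring
  have hcos : ∀ x : ℝ, Real.cos (x + φ) + Real.cos (x - φ) = 2 * Real.cos φ * Real.cos x := by
    intro x
    rw [Real.cos_add, Real.cos_sub]
    ring
  have key : ∀ k : ℕ, ((H ^ (k : ℤ) : unitaryGroup Y ℂ).1 z z = Real.cos (k * φ) ∧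
      (H ^ ((k : ℤ) + 1) : unitaryGroup Y ℂ).1 z z = Real.cos ((k + 1) * φ)) ∧
      ((H ^ (-(k : ℤ)) : unitaryGroup Y ℂ).1 z z = Real.cos (k * φ) ∧
      (H ^ (-(k : ℤ) - 1) : unitaryGroup Y ℂ).1 z z = Real.cos ((k + 1) * φ)) := by
    intro k
    induction k with
    | zero => simp [h1, h2]
    | succ k ih =>
      obtain ⟨⟨a1, a2⟩, b1, b2⟩ := ih
      have hc := hcos ((k + 1) * φ)
      rw [show ((k : ℝ) + 1) * φ + φ = (k + 1 + 1) * φ by ring,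
        show ((k : ℝ) + 1) * φ - φ = k * φ by ring] at hc
      have hc' : (Real.cos ((k + 1 + 1) * φ) : ℂ)
          = 2 * Real.cos φ * Real.cos ((k + 1) * φ) - Real.cos (k * φ) := by
        rw [← sub_eq_of_eq_add' (hc.symm.trans (add_comm _ _))]
        push_cast
        ring
      have e1 := hrec ((k : ℤ) + 1)
      have e2 := hrec (-(k : ℤ) - 1)
      rw [add_sub_cancel_right, a1, a2] at e1
      rw [sub_add_cancel, b1, b2] at e2
      simp only [Nat.cast_add, Nat.cast_one]
      rw [neg_add', hc']
      exact ⟨⟨a2, by rw [← e1]; ring⟩, b2, by rw [← e2]; ring⟩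
  obtain ⟨k, rfl | rfl⟩ := n.eq_nat_or_neg
  · exact_mod_cast (key k).1.1
  · rw [(key k).2.1]
    rw [Int.cast_neg, Int.cast_natCast, neg_mul, Real.cos_neg]

open Matrix in
-- Expanding the square leaves only the overlaps of `Hᵏz` and `Hʲz`, which are `cos((j-k)φ)`, half
-- the sum of `exp(±i(j-k)φ)`. So the outcomes are distributed as if `z` were an equal mixture of
-- eigenvectors with phases `φ` and `-φ`.
theorem sum_normSq_phase {H : unitaryGroup Y ℂ} {z : Y} {φ : ℝ}
    (h : ∀ n : ℤ, (H ^ n : unitaryGroup Y ℂ).1 z z = Real.cos (n * φ)) (M : ℕ) (y : ℝ) :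
    ∑ x, ‖(1 / M : ℂ) * ∑ j ∈ Finset.range M,
        Complex.exp (Complex.I * (-(2 * Real.pi * y / M) : ℝ)) ^ j * (H ^ j : unitaryGroup Y ℂ).1 x z‖ ^ 2
      = (phaseKernel M (M * φ / (2 * Real.pi) - y)
        + phaseKernel M (-(M * φ / (2 * Real.pi)) - y)) / 2 := by
  rcases eq_or_ne M 0 with rfl | hM
  · simp [phaseKernel]
  have hM0 : (M : ℝ) ≠ 0 := by exact_mod_cast hM
  set ω := Complex.exp (Complex.I * (-(2 * Real.pi * y / M) : ℝ)) with hω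
  have hz : ∀ s : ℝ, Complex.exp (Complex.I * (2 * Real.pi * (M * s / (2 * Real.pi) - y) / M : ℝ))
      = ω * Complex.exp (Complex.I * (s : ℝ)) := by
    intro s
    rw [hω, ← Complex.exp_add]
    congr 1
    have : 2 * Real.pi * (M * s / (2 * Real.pi) - y) / M = -(2 * Real.pi * y / M) + s := by
      field_simp
      ring
    rw [this]
    push_cast
    ring
  clear_value ω
  have hconj : ∀ s : ℝ, (starRingEnd ℂ) (Complex.exp (Complex.I * s))
      = Complex.exp (Complex.I * (-s : ℝ)) := by
    intro s
    rw [← Complex.exp_conj]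
    simp
  have hk : ∀ s : ℝ, ((phaseKernel M (M * s / (2 * Real.pi) - y) : ℝ) : ℂ)
      = (∑ k ∈ Finset.range M, ∑ j ∈ Finset.range M, (starRingEnd ℂ) ω ^ k * ω ^ j
        * Complex.exp (Complex.I * (((j : ℝ) - k) * s : ℝ))) / M ^ 2 := by
    intro s
    rw [phaseKernel, hz]
    push_cast
    rw [← Complex.conj_mul', map_sum, Finset.sum_mul_sum]
    congr 1
    refine Finset.sum_congr rfl fun k _ => Finset.sum_congr rfl fun j _ => ?_
    rw [map_pow, map_mul, hconj, mul_pow, mul_pow, ← Complex.exp_nat_mul, ← Complex.exp_nat_mul]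
    have : Complex.exp (Complex.I * ((j - k) * s)) = Complex.exp (k * (Complex.I * (-s : ℝ)))
        * Complex.exp (j * (Complex.I * s)) := by
      rw [← Complex.exp_add]
      congr 1
      push_cast
      ring
    rw [this]
    ring
  have hstar : ∀ k j : ℕ, ∑ x, (starRingEnd ℂ) ((H ^ k : unitaryGroup Y ℂ).1 x z)
      * (H ^ j : unitaryGroup Y ℂ).1 x z = Real.cos (((j : ℝ) - k) * φ) := by
    intro k j
    have h1 := h ((j : ℤ) - k)
    rw [_root_.zpow_sub, zpow_natCast, zpow_natCast, ← (Commute.refl H).pow_pow k j |>.inv_left.eq,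
      Submonoid.coe_mul, mul_apply] at h1
    rw [Int.cast_sub, Int.cast_natCast, Int.cast_natCast] at h1
    rw [← h1]
    exact Finset.sum_congr rfl fun x _ => rfl
  apply Complex.ofReal_injective
  have hk2 := hk (-φ)
  rw [show (M : ℝ) * (-φ) / (2 * Real.pi) = -(M * φ / (2 * Real.pi)) by ring] at hk2
  rw [Complex.ofReal_div, Complex.ofReal_add, hk, hk2, ← add_div, ← Finset.sum_add_distrib]
  simp only [← Finset.sum_add_distrib, ← mul_add]
  simp only [Complex.ofReal_sum, Complex.ofReal_pow, Complex.ofReal_ofNat]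
  have hlhs : ∀ x, ((‖(1 / M : ℂ) * ∑ j ∈ Finset.range M, ω ^ j * (H ^ j : unitaryGroup Y ℂ).1 x z‖ : ℝ) : ℂ) ^ 2
      = (∑ k ∈ Finset.range M, ∑ j ∈ Finset.range M, (starRingEnd ℂ) ω ^ k * ω ^ j *
        ((starRingEnd ℂ) ((H ^ k : unitaryGroup Y ℂ).1 x z) * (H ^ j : unitaryGroup Y ℂ).1 x z)) / M ^ 2 := by
    intro x
    rw [← Complex.conj_mul', map_mul, map_sum, map_div₀, map_one, Complex.conj_natCast]
    rw [mul_mul_mul_comm, Finset.sum_mul_sum]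
    simp only [map_mul, map_pow]
    rw [div_mul_div_comm, one_mul, ← sq, one_div_mul_eq_div]
    congr 1
    refine Finset.sum_congr rfl fun k _ => Finset.sum_congr rfl fun j _ => ?_
    ring
  rw [Finset.sum_congr rfl fun x _ => hlhs x, ← Finset.sum_div, Finset.sum_comm, div_right_comm]
  congr 1
  rw [Finset.sum_div]
  refine Finset.sum_congr rfl fun k _ => ?_
  rw [Finset.sum_comm, Finset.sum_div]
  refine Finset.sum_congr rfl fun j _ => ?_
  rw [← Finset.mul_sum, hstar, mul_div_assoc]
  congr 1
  push_cast
  rw [Complex.cos]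
  congr 2 <;> [skip; skip]
  · congr 1
    ring
  · congr 1
    ring

end PhaseEstimation

open Matrix

/-! ### Block-diagonal circuits -/

section Blocks

variable {ι κ A : Type} [Fintype ι] [DecidableEq ι] [Fintype κ] [DecidableEq κ]
  [Fintype A] [DecidableEq A]

theorem select_apply (B : A → unitaryGroup ι ℂ) (x y : ι × A) :
    (select B).1 x y = if x.2 = y.2 then (B x.2).1 x.1 y.1 else 0 := by
  obtain ⟨x, a⟩ := x
  obtain ⟨y, b⟩ := y
  rfl

theorem tensor_apply (U : unitaryGroup ι ℂ) (V : unitaryGroup κ ℂ) (x y : ι × κ) :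
    (tensor U V).1 x y = U.1 x.1 y.1 * V.1 x.2 y.2 := rfl

theorem relabel_apply (e : κ ≃ ι) (U : unitaryGroup ι ℂ) (x y : κ) :
    (relabel e U).1 x y = U.1 (e x) (e y) := rfl

theorem signFlip_apply (s : ι → Prop) [DecidablePred s] (x y : ι) :
    (signFlip s).1 x y = if x = y then (if s x then -1 else 1) else 0 :=
  diagonal_apply _ _ _

theorem inv_apply (U : unitaryGroup ι ℂ) (x y : ι) :
    (U⁻¹ : unitaryGroup ι ℂ).1 x y = (starRingEnd ℂ) (U.1 y x) := rfl

theorem mul_apply' (U V : unitaryGroup ι ℂ) (x y : ι) :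
    (U * V).1 x y = ∑ z, U.1 x z * V.1 z y := by
  rw [Submonoid.coe_mul, mul_apply]

theorem one_apply' (x y : ι) : (1 : unitaryGroup ι ℂ).1 x y = if x = y then 1 else 0 := rfl

theorem unitary_ext {U V : unitaryGroup ι ℂ} (h : ∀ x y, U.1 x y = V.1 x y) : U = V :=
  Subtype.ext (Matrix.ext h)

theorem sum_normSq_col (U : unitaryGroup ι ℂ) (x : ι) : ∑ y, ‖U.1 y x‖ ^ 2 = 1 := by
  have h : (U⁻¹ * U).1 x x = 1 := by rw [inv_mul_cancel, one_apply', if_pos rfl]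
  rw [mul_apply'] at h
  apply Complex.ofReal_injective
  rw [Complex.ofReal_one, ← h]
  push_cast
  exact Finset.sum_congr rfl fun y _ => by rw [inv_apply, Complex.conj_mul']

theorem sum_normSq_mulVec (U : unitaryGroup ι ℂ) (v : ι → ℂ) :
    ∑ y, ‖∑ x, U.1 y x * v x‖ ^ 2 = ∑ x, ‖v x‖ ^ 2 := by
  apply Complex.ofReal_injective
  push_cast
  simp only [← Complex.conj_mul']
  have h1 : ∀ w : ι → ℂ, ∑ x, (starRingEnd ℂ) (w x) * w x = star w ⬝ᵥ w := fun w => rfl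
  have h2 : star (U.1 *ᵥ v) ⬝ᵥ (U.1 *ᵥ v) = star v ⬝ᵥ v := by
    rw [star_mulVec, dotProduct_mulVec, vecMul_vecMul, ← star_eq_conjTranspose,
      mem_unitaryGroup_iff'.1 U.2, vecMul_one]
  exact h2

/-- `select` as a homomorphism. -/
def selectHom : (A → unitaryGroup ι ℂ) →* unitaryGroup (ι × A) ℂ where
  toFun := select
  map_one' := by
    refine unitary_ext fun x y => ?_
    simp only [select_apply, one_apply', Pi.one_apply, Prod.ext_iff]
    split_ifs <;> simp_all
  map_mul' B C := by
    refine unitary_ext fun x y => ?_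
    rw [select_apply, mul_apply', Fintype.sum_prod_type, Pi.mul_apply, mul_apply']
    simp only [select_apply]
    by_cases h : x.2 = y.2 <;> simp [h]

theorem selectHom_apply (B : A → unitaryGroup ι ℂ) : selectHom B = select B := rfl

/-- `relabel` as a homomorphism. -/
def relabelHom (e : κ ≃ ι) : unitaryGroup ι ℂ →* unitaryGroup κ ℂ where
  toFun := relabel e
  map_one' := by
    refine unitary_ext fun x y => ?_
    simp [relabel_apply, one_apply']
  map_mul' U V := by
    refine unitary_ext fun x y => ?_
    rw [relabel_apply, mul_apply', mul_apply', ← e.sum_comp]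
    rfl

theorem relabelHom_apply (e : κ ≃ ι) (U : unitaryGroup ι ℂ) : relabelHom e U = relabel e U := rfl

theorem tensor_one_commute_select_const (U : unitaryGroup ι ℂ) (Q : unitaryGroup A ℂ) :
    Commute (tensor 1 Q) (select fun _ => U) := by
  refine unitary_ext fun x y => ?_
  rw [mul_apply', mul_apply', Fintype.sum_prod_type, Fintype.sum_prod_type]
  simp [select_apply, tensor_apply, one_apply', mul_comm]

theorem conj_tensor_one_select_apply (B : A → unitaryGroup ι ℂ) (Q : unitaryGroup A ℂ)
    (x x' : ι) (y y' : A) :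
    ((tensor 1 Q)⁻¹ * (select B * tensor 1 Q)).1 (x, y) (x', y')
      = ∑ j, (starRingEnd ℂ) (Q.1 j y) * Q.1 j y' * (B j).1 x x' := by
  have h1 : ∀ z, (select B * tensor 1 Q).1 z (x', y') = (B z.2).1 z.1 x' * Q.1 z.2 y' := by
    intro z
    rw [mul_apply', Fintype.sum_prod_type]
    simp [select_apply, tensor_apply, one_apply']
  rw [mul_apply', Fintype.sum_prod_type_right]
  refine Finset.sum_congr rfl fun j _ => ?_
  simp only [h1, inv_apply, tensor_apply, one_apply', apply_ite, map_zero,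
    ite_mul, one_mul, zero_mul, Finset.sum_ite_eq', Finset.mem_univ, if_true]
  ring

/-- A family of unitaries, selected by the last of three registers. -/
def onLast {X L J : Type} [Fintype X] [DecidableEq X] [Fintype L] [DecidableEq L] [Fintype J]
    [DecidableEq J] : (J → unitaryGroup (X × L) ℂ) →* unitaryGroup (X × (L × J)) ℂ :=
  (relabelHom (Equiv.prodAssoc X L J).symm).comp selectHom

theorem onLast_apply {X L J : Type} [Fintype X] [DecidableEq X] [Fintype L] [DecidableEq L]
    [Fintype J] [DecidableEq J] (B : J → unitaryGroup (X × L) ℂ) (x y : X × (L × J)) :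
    (onLast B).1 x y
      = if x.2.2 = y.2.2 then (B x.2.2).1 (x.1, x.2.1) (y.1, y.2.1) else 0 :=
  select_apply _ _ _

end Blocks

/-! ### Evaluation of circuits with controlled repetitions. -/

section Circuits

variable {X A : Type} [Fintype X] [DecidableEq X] [Fintype A] [DecidableEq A]
  (W : unitaryGroup X ℂ)

theorem Circuit.eval_append (c c' : Circuit X A) :
    Circuit.eval W (c ++ c') = Circuit.eval W c' * Circuit.eval W c := by
  induction c with
  | nil => simp [Circuit.eval]
  | cons g c ih => rw [List.cons_append, Circuit.eval, ih, Circuit.eval, mul_assoc]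

theorem Circuit.eval_cons (g : Gate X A) (c : Circuit X A) :
    Circuit.eval W (g :: c) = Circuit.eval W c * g.eval W := rfl

theorem Circuit.eval_nil : Circuit.eval W ([] : Circuit X A) = 1 := rfl

/-- Block `i` acts only if the control exceeds `i`, so `k` blocks apply `U` exactly `min k a` times.
The homomorphism `Φ` covers both uses: powers of the walk, controlled on the first ancilla, and
powers of the Grover operator, controlled on the phase register. -/
theorem Circuit.eval_flatMap_range {G : Type} [Group G] {n : ℕ}
    (Φ : (Fin (n + 1) → G) →* unitaryGroup (X × A) ℂ) (U : G) (c : ℕ → Circuit X A)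
    (hc : ∀ i, Circuit.eval W (c i) = Φ fun a => if i < (a : ℕ) then U else 1) :
    Circuit.eval W ((List.range n).flatMap c) = Φ fun a => U ^ (a : ℕ) := by
  have key : ∀ k, Circuit.eval W ((List.range k).flatMap c) = Φ fun a => U ^ (min k (a : ℕ)) := by
    intro k
    induction k with
    | zero =>
      simp only [List.range_zero, List.flatMap_nil, Nat.zero_min, pow_zero]
      exact (map_one Φ).symm
    | succ k ih =>
      rw [List.range_succ, List.flatMap_append, Circuit.eval_append, ih, List.flatMap_singleton,
        hc, ← map_mul]
      congr 1
      funext a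
      rw [Pi.mul_apply]
      split_ifs with h
      · rw [min_eq_left h.le, min_eq_left (Nat.succ_le_of_lt h), pow_succ']
      · rw [one_mul, min_eq_right (by omega), min_eq_right (by omega)]
  rw [key]
  congr 1
  funext a
  rw [min_eq_right (Nat.lt_succ_iff.1 a.2)]

end Circuits

/-! ### Amplitude estimation -/

section AmplitudeEstimation

/-- The operator is `R_z B` with `B` a self-inverse reflection, and its inverse is `B R_z`. In
column `z` their sum cancels off the diagonal and equals `-2 B_zz` on it. The squared amplitude `a²`
on `S` gives `B_zz = 2a² - 1 = -cos(2 arcsin a)`. -/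
theorem grover_zpow_apply {Y : Type} [Fintype Y] [DecidableEq Y] (F : unitaryGroup Y ℂ) (z : Y)
    (S : Y → Prop) [DecidablePred S] {a : ℝ}
    (ha0 : 0 ≤ a) (ha : a ^ 2 = ∑ x, if S x then ‖F.1 x z‖ ^ 2 else 0) (n : ℤ) :
    ((signFlip (fun x => x = z) * (F⁻¹ * signFlip (fun x => ¬ S x) * F)) ^ n
      : unitaryGroup Y ℂ).1 z z = Real.cos (n * (2 * Real.arcsin a)) := by
  set B := F⁻¹ * signFlip (fun x => ¬ S x) * F with hB
  have hinv : ∀ (s : Y → Prop) [DecidablePred s], (signFlip s)⁻¹ = signFlip s := by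
    intro s _
    refine unitary_ext fun x y => ?_
    rw [inv_apply, signFlip_apply, signFlip_apply]
    by_cases h : x = y
    · subst h
      by_cases hs : s x <;> simp [hs]
    · simp [h, Ne.symm h]
  have hBinv : B⁻¹ = B := by
    rw [hB, _root_.mul_inv_rev, _root_.mul_inv_rev, hinv, inv_inv, mul_assoc]
  have hcol := sum_normSq_col F z
  have ha1 : a ≤ 1 := by
    have : a ^ 2 ≤ 1 := by
      rw [ha, ← hcol]
      gcongr
      split_ifs
      · exact le_rfl
      · positivity
    nlinarith
  have hcos : Real.cos (2 * Real.arcsin a) = 1 - 2 * a ^ 2 := by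
    rw [Real.cos_two_mul', Real.sin_arcsin (by linarith) ha1, Real.cos_arcsin,
      Real.sq_sqrt (by nlinarith)]
    ring
  have hBz : B.1 z z = -(Real.cos (2 * Real.arcsin a) : ℂ) := by
    have h1 : B.1 z z = ((∑ x, (if S x then ‖F.1 x z‖ ^ 2 else -‖F.1 x z‖ ^ 2) : ℝ) : ℂ) := by
      rw [hB, mul_apply', Complex.ofReal_sum]
      refine Finset.sum_congr rfl fun x _ => ?_
      rw [mul_apply']
      simp only [signFlip_apply, mul_ite, mul_zero, Finset.sum_ite_eq', Finset.mem_univ, if_true,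
        inv_apply]
      by_cases h : S x <;> simp [h, Complex.conj_mul']
    have h2 : ∀ x, (if S x then ‖F.1 x z‖ ^ 2 else -‖F.1 x z‖ ^ 2)
        = 2 * (if S x then ‖F.1 x z‖ ^ 2 else 0) - ‖F.1 x z‖ ^ 2 := by
      intro x
      split_ifs <;> ring
    rw [h1, Finset.sum_congr rfl fun x _ => h2 x, Finset.sum_sub_distrib, ← Finset.mul_sum, ← ha,
      hcol, hcos]
    push_cast
    ring
  have hl : ∀ x, (signFlip (fun x => x = z) * B).1 x z = (if x = z then -1 else 1) * B.1 x z := by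
    intro x
    rw [mul_apply']
    simp [signFlip_apply]
  have hr : ∀ x, ((signFlip (fun x => x = z) * B)⁻¹ : unitaryGroup Y ℂ).1 x z = - B.1 x z := by
    intro x
    rw [_root_.mul_inv_rev, hinv, hBinv, mul_apply']
    simp [signFlip_apply]
  refine zpow_apply_of_add_inv ?_ ?_ (fun x => ?_) n
  · rw [hl, if_pos rfl, hBz]
    ring
  · rw [hr, hBz, neg_neg]
  · rw [hl, hr]
    by_cases h : x = z
    · rw [if_pos h, if_pos h, h, hBz]
      ring
    · rw [if_neg h, if_neg h]
      ring

theorem conj_qft_mul (m : ℕ) (j y : Fin (m + 1)) :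
    (starRingEnd ℂ) ((qft m).1 j y) * (qft m).1 j 0
      = (1 / ((m + 1 : ℕ) : ℂ)) *
        Complex.exp (Complex.I * (-(2 * Real.pi * (y : ℕ) / (m + 1 : ℕ)) : ℝ)) ^ (j : ℕ) := by
  have hsq : (Real.sqrt ((m : ℝ) + 1) : ℂ) * (Real.sqrt ((m : ℝ) + 1) : ℂ) = (m : ℂ) + 1 := by
    rw [← Complex.ofReal_mul, Real.mul_self_sqrt (by positivity)]
    push_cast
    rfl
  change (starRingEnd ℂ) (qftMatrix m j y) * qftMatrix m j 0 = _
  rw [qftMatrix, qftMatrix, map_div₀, Complex.conj_ofReal, div_mul_div_comm, hsq,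
    ← Complex.exp_conj, ← Complex.exp_add, ← Complex.exp_nat_mul, div_eq_mul_one_div, mul_comm]
  push_cast
  congr 2
  simp only [map_div₀, map_mul, Complex.conj_I, Complex.conj_ofReal, map_natCast, map_ofNat,
    map_add, map_one, Fin.val_zero, Nat.cast_zero]
  ring

variable {N : ℕ} (W : unitaryGroup (Coined N) ℂ) (t τ m : ℕ) (u : Fin N)

/-- The fast-forwarding operator on the walk space and the register of the linear combination. -/
def fastForwardUnitary : unitaryGroup (Coined N × Fin (τ + 1)) ℂ :=
  (tensor 1 (householder 0 fun l : Fin (τ + 1) => Real.sqrt (truncCoeff t τ l)))⁻¹ *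
    select (fun l : Fin (τ + 1) => W ^ (l : ℕ)) *
    tensor 1 (householder 0 fun l : Fin (τ + 1) => Real.sqrt (truncCoeff t τ l))

theorem prepare_eq_onLast : prepare N t τ m = onLast fun _ =>
    tensor 1 (householder 0 fun l : Fin (τ + 1) => Real.sqrt (truncCoeff t τ l)) := by
  refine unitary_ext fun x y => ?_
  rw [onLast_apply, prepare, tensor_apply, tensor_apply, tensor_apply, one_apply', one_apply']
  by_cases h : x.2.2 = y.2.2 <;> simp [h]

theorem eval_fastForward :
    Circuit.eval W (fastForward N t τ m) = onLast fun _ => fastForwardUnitary W t τ := by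
  have hw : Circuit.eval W ((List.range τ).map fun i =>
      (Gate.walk fun a : Anc τ m => decide (i < (a.1 : ℕ)) : Gate (Coined N) (Anc τ m)))
      = onLast fun _ => select fun l : Fin (τ + 1) => W ^ (l : ℕ) := by
    rw [← List.flatMap_pure_eq_map]
    refine Circuit.eval_flatMap_range W
      (onLast.comp ((Pi.constMonoidHom (Fin (m + 1)) _).comp selectHom)) W _ fun i => ?_
    change 1 * select (fun a : Anc τ m => if decide (i < (a.1 : ℕ)) then W else 1) = onLast _
    refine unitary_ext fun x y => ?_
    rw [one_mul, onLast_apply, select_apply]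
    change _ = if x.2.2 = y.2.2 then (select _).1 _ _ else 0
    simp only [select_apply, Prod.ext_iff]
    by_cases h : x.2.2 = y.2.2 <;> simp [h]
  rw [fastForward, Circuit.eval_append, Circuit.eval_cons, Circuit.eval_cons, Circuit.eval_nil, hw,
    one_mul, Gate.eval, Gate.eval, prepare_eq_onLast, ← map_inv, ← map_mul, ← map_mul]
  congr 1
  funext j
  simp only [Pi.mul_apply, Pi.inv_apply, fastForwardUnitary, mul_assoc]

theorem eval_fastForwardInv :
    Circuit.eval W (fastForwardInv N t τ m) = onLast fun _ => (fastForwardUnitary W t τ)⁻¹ := by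
  have hw : Circuit.eval W ((List.range τ).map fun i =>
      (Gate.walkInv fun a : Anc τ m => decide (i < (a.1 : ℕ)) : Gate (Coined N) (Anc τ m)))
      = onLast fun _ => (select fun l : Fin (τ + 1) => W ^ (l : ℕ))⁻¹ := by
    have hinv : (select fun l : Fin (τ + 1) => W ^ (l : ℕ))⁻¹
        = select fun l : Fin (τ + 1) => W⁻¹ ^ (l : ℕ) := by
      rw [← selectHom_apply, ← map_inv, selectHom_apply]
      congr 1
      funext l
      simp
    rw [← List.flatMap_pure_eq_map, hinv]
    refine Circuit.eval_flatMap_range W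
      (onLast.comp ((Pi.constMonoidHom (Fin (m + 1)) _).comp selectHom)) W⁻¹ _ fun i => ?_
    change 1 * select (fun a : Anc τ m => if decide (i < (a.1 : ℕ)) then W⁻¹ else 1) = onLast _
    refine unitary_ext fun x y => ?_
    rw [one_mul, onLast_apply, select_apply]
    change _ = if x.2.2 = y.2.2 then (select _).1 _ _ else 0
    simp only [select_apply, Prod.ext_iff]
    by_cases h : x.2.2 = y.2.2 <;> simp [h]
  rw [fastForwardInv, Circuit.eval_append, Circuit.eval_cons, Circuit.eval_cons, Circuit.eval_nil,
    hw, one_mul, Gate.eval, Gate.eval, prepare_eq_onLast, ← map_inv, ← map_mul, ← map_mul]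
  congr 1
  funext j
  simp only [Pi.mul_apply, Pi.inv_apply, fastForwardUnitary, _root_.mul_inv_rev, inv_inv, mul_assoc]

/-- The Grover operator, conjugated by the fast-forwarding operator. -/
def groverUnitary : unitaryGroup (Coined N × Fin (τ + 1)) ℂ :=
  signFlip (fun z => z = ((u, none), 0)) * ((fastForwardUnitary W t τ)⁻¹ *
    signFlip (fun z => ¬ (z.1.2 = none ∧ z.2 = 0)) * fastForwardUnitary W t τ)

theorem signFlip_eq_onLast (i : ℕ) (s : Coined N × Fin (τ + 1) → Prop) [DecidablePred s]
    [DecidablePred fun z : Coined N × Anc τ m => i < (z.2.2 : ℕ) ∧ s (z.1, z.2.1)] :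
    signFlip (fun z : Coined N × Anc τ m => i < (z.2.2 : ℕ) ∧ s (z.1, z.2.1))
      = onLast fun j : Fin (m + 1) => if i < (j : ℕ) then signFlip s else 1 := by
  refine unitary_ext fun x y => ?_
  rw [onLast_apply, signFlip_apply]
  obtain ⟨x, l, j⟩ := x
  obtain ⟨y, l', j'⟩ := y
  by_cases h : j = j'
  · subst h
    by_cases hi : i < (j : ℕ)
    · simp [hi, signFlip_apply]
    · simp [hi, one_apply']
  · simp [h]

/-- Written as a conjugate by the fast-forwarding operator so that inner factors cancel in powers.
-/
theorem eval_grover (i : ℕ) : Circuit.eval W (grover t τ m u i)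
    = onLast fun j : Fin (m + 1) => if i < (j : ℕ) then
      fastForwardUnitary W t τ * groverUnitary W t τ u * (fastForwardUnitary W t τ)⁻¹ else 1 := by
  have h1 := signFlip_eq_onLast (N := N) τ m i (fun z => ¬ (z.1.2 = none ∧ z.2 = 0))
  have h2 := signFlip_eq_onLast τ m i (fun z => z = (((u, none), 0) : Coined N × Fin (τ + 1)))
  simp only [Prod.mk.injEq] at h2
  rw [grover, Circuit.eval_append, Circuit.eval_cons, Circuit.eval_cons, eval_fastForward,
    eval_fastForwardInv, Gate.eval, Gate.eval, h1, h2, ← map_mul, ← map_mul, ← map_mul]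
  congr 1
  funext j
  simp only [Pi.mul_apply]
  split_ifs with h
  · simp only [groverUnitary, mul_assoc, mul_inv_cancel, mul_one]
  · simp

/-- The fast-forwarding operator ignores the phase register, hence commutes with the Fourier
transform. It can be pulled out to the left, which turns the initial state into a basis state for
the conjugated Grover operator. -/
theorem eval_estimationCircuit : Circuit.eval W (estimationCircuit t τ m u)
    = relabel (Equiv.prodAssoc (Coined N) (Fin (τ + 1)) (Fin (m + 1))).symm
      (select (fun _ => fastForwardUnitary W t τ) * ((tensor 1 (qft m))⁻¹ *
        (select (fun j : Fin (m + 1) => groverUnitary W t τ u ^ (j : ℕ)) * tensor 1 (qft m)))) := by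
  have hq : phaseQft N τ m = relabelHom
      (Equiv.prodAssoc (Coined N) (Fin (τ + 1)) (Fin (m + 1))).symm (tensor 1 (qft m)) := by
    refine unitary_ext fun x y => ?_
    rw [phaseQft, relabelHom_apply, relabel_apply, tensor_apply, tensor_apply, tensor_apply,
      one_apply', one_apply', one_apply']
    simp only [Equiv.prodAssoc_symm_apply, Prod.mk.injEq]
    by_cases h : x.1 = y.1 <;> simp [h]
  have hg := Circuit.eval_flatMap_range W (onLast (X := Coined N) (L := Fin (τ + 1)))
    (fastForwardUnitary W t τ * groverUnitary W t τ u * (fastForwardUnitary W t τ)⁻¹)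
    (grover t τ m u) (eval_grover W t τ m u)
  rw [estimationCircuit, Circuit.eval_append, Circuit.eval_append, Circuit.eval_cons,
    Circuit.eval_cons, Circuit.eval_nil, hg, eval_fastForward, one_mul, Gate.eval, Gate.eval, hq,
    ← map_inv]
  simp only [onLast, MonoidHom.comp_apply, ← map_mul]
  rw [relabelHom_apply]
  congr 1
  have hc := tensor_one_commute_select_const (fastForwardUnitary W t τ) (qft m)
  have hpow : (selectHom fun j : Fin (m + 1) =>
      (fastForwardUnitary W t τ * groverUnitary W t τ u * (fastForwardUnitary W t τ)⁻¹) ^ (j : ℕ))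
      = select (fun _ => fastForwardUnitary W t τ) *
        select (fun j : Fin (m + 1) => groverUnitary W t τ u ^ (j : ℕ)) *
        (select fun _ => fastForwardUnitary W t τ)⁻¹ := by
    simp only [← selectHom_apply, ← map_mul, ← map_inv]
    congr 1
    funext j
    simp [conj_pow]
  rw [hpow, selectHom_apply]
  simp only [mul_assoc, hc.eq, inv_mul_cancel_left]
  exact hc.inv_left.left_comm _

theorem flat_normSq {a : ℝ} (ha : a ^ 2 = ∑ i, ‖(fastForwardUnitary W t τ).1 ((i, none), 0)
    ((u, none), 0)‖ ^ 2) : a ^ 2 = ∑ x : Coined N × Fin (τ + 1),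
      if x.1.2 = none ∧ x.2 = 0 then
        ‖(fastForwardUnitary W t τ).1 x ((u, none), 0)‖ ^ 2 else 0 := by
  rw [ha, Fintype.sum_prod_type, Fintype.sum_prod_type]
  refine Finset.sum_congr rfl fun i _ => ?_
  rw [Fintype.sum_option, Fintype.sum_eq_single (0 : Fin (τ + 1))]
  · simp
  · intro l hl
    simp [hl]

/-- The phases `s` and `-s` give the same value `|sin(πs/M)| = a`, so both halves of the outcome law
concentrate on estimates close to `a`. -/
theorem mean_estimateOnce_le {a : ℝ} (ha0 : 0 ≤ a)
    (ha : a ^ 2 = ∑ i, ‖(fastForwardUnitary W t τ).1 ((i, none), 0) ((u, none), 0)‖ ^ 2)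
    {η : ℝ} (hη : 4 * Real.pi / ((m + 1 : ℕ) : ℝ) ≤ η) :
    (estimateOnce t τ m u).mean W ({b | |b - a| ≤ η}ᶜ.indicator 1) ≤ ENNReal.ofReal (1 / 6) := by
  set φ := 2 * Real.arcsin a with hφ
  set s : ℝ := ((m + 1 : ℕ) : ℝ) * φ / (2 * Real.pi) with hs
  have hM : ((m + 1 : ℕ) : ℝ) ≠ 0 := by positivity
  have hsa : |Real.sin (Real.pi * s / (m + 1 : ℕ))| = a := by
    have : Real.pi * s / (m + 1 : ℕ) = Real.arcsin a := by
      rw [hs, hφ]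
      field_simp
    have ha1 : a ≤ 1 := by
      have : a ^ 2 ≤ 1 := by
        rw [flat_normSq W t τ u ha, ← sum_normSq_col (fastForwardUnitary W t τ) ((u, none), 0)]
        gcongr
        split_ifs
        · exact le_rfl
        · positivity
      nlinarith
    rw [this, Real.sin_arcsin (by linarith) ha1, abs_of_nonneg ha0]
  have hsa' : |Real.sin (Real.pi * (-s) / (m + 1 : ℕ))| = a := by
    rw [← hsa, mul_neg, neg_div, Real.sin_neg, abs_neg]
  have hk1 := sum_phaseKernel_le (M := m + 1) (Nat.succ_ne_zero m) s
  have hk2 := sum_phaseKernel_le (M := m + 1) (Nat.succ_ne_zero m) (-s)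
  rw [hsa] at hk1
  rw [hsa'] at hk2
  set e := Equiv.prodAssoc (Coined N) (Fin (τ + 1)) (Fin (m + 1))
  set z₀ : Coined N × Fin (τ + 1) := ((u, none), 0) with hz₀
  have hrow : ∀ y : Fin (m + 1), ∑ x : Coined N × Fin (τ + 1),
      ‖(Circuit.eval W (estimationCircuit t τ m u)).1 (e (x, y)) ((u, none), (0, 0))‖ ^ 2
      = (phaseKernel (m + 1) (s - (y : ℕ)) + phaseKernel (m + 1) (-s - (y : ℕ))) / 2 := by
    intro y
    rw [← sum_normSq_phase (grover_zpow_apply (fastForwardUnitary W t τ) z₀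
      (fun z => z.1.2 = none ∧ z.2 = 0) ha0 (flat_normSq W t τ u ha))]
    -- Only the phase register is read out, so the leftmost unitary on the other registers does not
    -- affect the sum.
    refine Eq.trans ?_ (sum_normSq_mulVec (fastForwardUnitary W t τ) _)
    refine Finset.sum_congr rfl fun x _ => ?_
    congr 2
    rw [eval_estimationCircuit, relabel_apply, mul_apply', Fintype.sum_prod_type]
    refine Finset.sum_congr rfl fun x' _ => ?_
    simp only [select_apply, ite_mul, zero_mul]
    rw [Finset.sum_eq_single y (fun y' _ h => if_neg (by simpa [e] using h.symm)) (by simp)]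
    refine (if_pos rfl).trans ?_
    congr 1
    refine (conj_tensor_one_select_apply _ _ _ _ _ _).trans ?_
    rw [Finset.sum_range, Finset.mul_sum]
    refine Finset.sum_congr rfl fun j _ => ?_
    rw [conj_qft_mul, mul_assoc]
    rfl
  rw [estimateOnce, Prog.mean_run]
  simp only [Prog.mean_ret]
  rw [expect, tsum_fintype, ← e.sum_comp, Fintype.sum_prod_type_right]
  have hy : ∀ y : Fin (m + 1), ∑ x : Coined N × Fin (τ + 1),
      measure (Circuit.eval W (estimationCircuit t τ m u)) ((u, none), 0, 0) (e (x, y))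
        * {b | |b - a| ≤ η}ᶜ.indicator 1 (Real.sin (Real.pi * ((e (x, y)).2.2 : ℕ) / (m + 1)))
      ≤ ENNReal.ofReal (((if |Real.sin (Real.pi * (y : ℕ) / (m + 1 : ℕ)) - a|
          ≤ 4 * Real.pi / (m + 1 : ℕ) then 0 else phaseKernel (m + 1) (s - (y : ℕ)))
        + (if |Real.sin (Real.pi * (y : ℕ) / (m + 1 : ℕ)) - a|
          ≤ 4 * Real.pi / (m + 1 : ℕ) then 0 else phaseKernel (m + 1) (-s - (y : ℕ)))) / 2) := by
    intro y
    change ∑ x : Coined N × Fin (τ + 1), ENNReal.ofReal _ *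
      {b | |b - a| ≤ η}ᶜ.indicator 1 (Real.sin (Real.pi * (y : ℕ) / (m + 1))) ≤ _
    rw [← Finset.sum_mul, ← ENNReal.ofReal_sum_of_nonneg (fun _ _ => by positivity), hrow]
    by_cases h : |Real.sin (Real.pi * (y : ℕ) / (m + 1 : ℕ)) - a| ≤ 4 * Real.pi / (m + 1 : ℕ)
    · have h' := h.trans hη
      push_cast at h'
      simp [h']
    · rw [if_neg h, if_neg h]
      refine mul_le_of_le_one_right zero_le (Set.indicator_le_self' (fun _ _ => zero_le) _)
  refine (Finset.sum_le_sum fun y _ => hy y).trans ?_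
  have hk0 : ∀ x, 0 ≤ phaseKernel (m + 1) x := fun x => by rw [phaseKernel]; positivity
  rw [← ENNReal.ofReal_sum_of_nonneg (fun y _ => by
    have := hk0 (s - (y : ℕ))
    have := hk0 (-s - (y : ℕ))
    split_ifs <;> linarith)]
  apply ENNReal.ofReal_le_ofReal
  rw [← Finset.sum_div, Finset.sum_add_distrib]
  linarith

end AmplitudeEstimation

/-! ### The spectrum of the quantum walk -/

section Spectrum

variable {N : ℕ} (G : SimpleGraph (Fin N)) [DecidableRel G.Adj] {d : ℕ}

theorem transition_nonneg (hd : ∀ v, G.degree v ≤ d) (v u : Fin N) : 0 ≤ transition G d v u := by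
  rw [transition]
  split_ifs
  · positivity
  · have : (G.degree u : ℝ) ≤ d := by exact_mod_cast hd u
    rw [sub_nonneg]
    apply div_le_one_of_le₀ <;> [linarith [Nat.cast_nonneg (α := ℝ) d]; positivity]
  · exact le_rfl

theorem sum_transition (u : Fin N) : ∑ v, transition G d v u = 1 := by
  have e : ∀ v, transition G d v u = (if G.Adj u v then (1 : ℝ) / (2 * d) else 0)
      + (if v = u then 1 - (G.degree u : ℝ) / (2 * d) else 0) := by
    intro v
    rw [transition]
    by_cases h : G.Adj u v
    · simp [h, h.ne']
    · simp [h]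
  simp only [e, Finset.sum_add_distrib, Finset.sum_ite_eq', Finset.mem_univ, if_true]
  rw [← Finset.sum_filter, Finset.sum_const, ← SimpleGraph.neighborFinset_eq_filter,
    SimpleGraph.card_neighborFinset_eq_degree, nsmul_eq_mul]
  ring

theorem sum_transition_pow (t : ℕ) (u : Fin N) : ∑ v, (transition G d ^ t) v u = 1 := by
  induction t generalizing u with
  | zero => simp [one_apply]
  | succ t ih =>
    simp only [pow_succ, mul_apply]
    rw [Finset.sum_comm]
    simp only [← Finset.sum_mul, ih, one_mul, sum_transition]

variable (V : CoinToss (transition G d))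

theorem CoinToss.unitary_apply (x y : Coined N) :
    V.unitary.1 x y = if x.1 = y.1 then (V.toss x.1).1 x.2 y.2 else 0 :=
  select_apply _ _ _

theorem shift_mul_apply (U : unitaryGroup (Coined N) ℂ) (x y : Coined N) :
    (shift G * U).1 x y = U.1 (shiftFun G x) y := by
  have h : ∀ z, (shift G).1 x z = if shiftFun G x = z then 1 else 0 := by
    intro z
    change (if x = shiftFun G z then (1 : ℂ) else 0) = _
    congr 1
    exact propext ⟨fun h => by rw [h, shiftFun_involutive], fun h => by
      rw [← h, shiftFun_involutive]⟩
  rw [mul_apply']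
  simp [h]

/-- The flat block of `V† S V` is the transition matrix. -/
theorem toss_shift_toss_apply (hd : ∀ v, G.degree v ≤ d) (j i : Fin N) :
    (V.unitary⁻¹ * shift G * V.unitary).1 (j, none) (i, none) = transition G d j i := by
  have hsq : ∀ v u, (Real.sqrt (transition G d v u) : ℂ) * Real.sqrt (transition G d v u)
      = transition G d v u := by
    intro v u
    rw [← Complex.ofReal_mul, Real.mul_self_sqrt (transition_nonneg G hd v u)]
  have h1 : (V.unitary⁻¹ * shift G * V.unitary).1 (j, none) (i, none)
      = ∑ k, (Real.sqrt (transition G d k j) : ℂ) *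
        V.unitary.1 (shiftFun G (j, some k)) (i, none) := by
    rw [mul_assoc, mul_apply', Fintype.sum_prod_type, Finset.sum_eq_single j]
    · rw [Fintype.sum_option]
      simp only [inv_apply, V.unitary_apply, shift_mul_apply, if_true, V.toss_flat, V.toss_node,
        map_zero, zero_mul, zero_add, Complex.conj_ofReal]
    · intro k _ hk
      simp [inv_apply, V.unitary_apply, hk]
    · simp
  rw [h1]
  -- The first register must end in `i`. On the diagonal only the unmoved state `|j,j⟩` contributes;
  -- off it, only the swapped edge `|j,i⟩`.
  by_cases hij : j = i
  · subst hij
    rw [Finset.sum_eq_single j]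
    · rw [shiftFun, if_neg (G.loopless.irrefl j), V.unitary_apply, if_pos rfl, V.toss_node, hsq]
    · intro k _ hk
      by_cases h : G.Adj j k
      · rw [shiftFun, if_pos h, V.unitary_apply, if_neg hk, mul_zero]
      · have : transition G d k j = 0 := by rw [transition, if_neg h, if_neg hk]
        rw [this, Real.sqrt_zero, Complex.ofReal_zero, zero_mul]
    · simp
  · rw [Finset.sum_eq_single i]
    · by_cases h : G.Adj j i
      · have : transition G d i j = transition G d j i := by
          rw [transition, transition, if_pos h, if_pos h.symm]
        rw [shiftFun, if_pos h, V.unitary_apply, if_pos rfl, V.toss_node, this, hsq]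
      · have h0 : transition G d j i = 0 := by
          rw [transition, if_neg (fun h' => h h'.symm), if_neg hij]
        have h0' : transition G d i j = 0 := by
          rw [transition, if_neg h, if_neg (Ne.symm hij)]
        rw [h0, h0', Real.sqrt_zero, Complex.ofReal_zero, zero_mul]
    · intro k _ hk
      by_cases h : G.Adj j k
      · rw [shiftFun, if_pos h, V.unitary_apply, if_neg hk, mul_zero]
      · rw [shiftFun, if_neg h, V.unitary_apply, if_neg hij, mul_zero]
    · simp

theorem signFlip_mul_apply {ι : Type} [Fintype ι] [DecidableEq ι] (s : ι → Prop) [DecidablePred s]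
    (U : unitaryGroup ι ℂ) (x y : ι) :
    (signFlip s * U).1 x y = (if s x then -1 else 1) * U.1 x y := by
  rw [mul_apply']
  simp [signFlip_apply]

theorem mul_signFlip_apply {ι : Type} [Fintype ι] [DecidableEq ι] (s : ι → Prop) [DecidablePred s]
    (U : unitaryGroup ι ℂ) (x y : ι) :
    (U * signFlip s).1 x y = U.1 x y * (if s y then -1 else 1) := by
  rw [mul_apply']
  simp [signFlip_apply]

theorem signFlip_inv {ι : Type} [Fintype ι] [DecidableEq ι] (s : ι → Prop) [DecidablePred s] :
    (signFlip s)⁻¹ = signFlip s := by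
  rw [inv_eq_iff_mul_eq_one]
  refine unitary_ext fun x y => ?_
  rw [signFlip_mul_apply, signFlip_apply, one_apply']
  by_cases h : s x <;> simp [h]

theorem shift_inv : (shift G)⁻¹ = shift G := by
  rw [inv_eq_iff_mul_eq_one]
  refine unitary_ext fun x y => ?_
  have := shift_mul_apply G 1 (shiftFun G x) y
  rw [mul_one, shiftFun_involutive G x] at this
  rw [shift_mul_apply, this]

theorem walkStep_inv : (walkStep G V)⁻¹
    = V.unitary⁻¹ * shift G * V.unitary * signFlip (fun z : Coined N => z.2 ≠ none) := by
  rw [walkStep]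
  simp only [_root_.mul_inv_rev, inv_inv, signFlip_inv, shift_inv, mul_assoc]

/-- On the flat subspace, `W + W⁻¹` acts as twice the transition matrix. -/
theorem walkStep_add_inv_apply (hd : ∀ v, G.degree v ≤ d) (x : Coined N) (i : Fin N) :
    (walkStep G V).1 x (i, none) + (walkStep G V)⁻¹.1 x (i, none)
      = if x.2 = none then 2 * (transition G d x.1 i : ℂ) else 0 := by
  rw [walkStep_inv, mul_signFlip_apply, walkStep, signFlip_mul_apply]
  obtain ⟨j, c⟩ := x
  cases c with
  | none =>
    rw [toss_shift_toss_apply G V hd]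
    simp
    ring
  | some k => simp

/-- The flat block of `Wᵏ`; this is the Chebyshev polynomial `T_k` of the transition matrix. -/
theorem walkStep_zpow_natAbs (k : ℤ) (i u : Fin N) :
    (walkStep G V ^ k).1 (i, none) (u, none)
      = (walkStep G V ^ k.natAbs).1 (i, none) (u, none) := by
  have hneg : (walkStep G V ^ (-k)).1 (i, none) (u, none)
      = (walkStep G V ^ k).1 (i, none) (u, none) := by
    set R := signFlip (fun z : Coined N => z.2 ≠ none) with hR
    -- The reflection reverses the walk and acts trivially on flat states, so `W` and its inverse
    -- have the same flat blocks.
    have h : R * walkStep G V * R⁻¹ = (walkStep G V)⁻¹ := by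
      have hRi : R⁻¹ = R := signFlip_inv _
      rw [walkStep_inv, walkStep, ← hR, ← mul_assoc R R, inv_eq_iff_mul_eq_one.1 hRi, one_mul, hRi]
    rw [_root_.zpow_neg, ← _root_.inv_zpow, ← h, conj_zpow, hR, signFlip_inv, mul_signFlip_apply,
      signFlip_mul_apply]
    simp
  rcases Int.natAbs_eq k with h | h
  · nth_rw 1 [h]
    rw [zpow_natCast]
  · rw [← hneg, ← zpow_natCast, show -k = (k.natAbs : ℤ) by omega]

/-- Both sides evaluate the flat block of `(W + W⁻¹)ᵗ`: one through its action as `2P`, the other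
through the binomial theorem, since `W` and `W⁻¹` commute. -/
theorem two_pow_mul_transition_pow (hd : ∀ v, G.degree v ≤ d) (t : ℕ) (i u : Fin N) :
    2 ^ t * ((transition G d ^ t) i u : ℂ) = ∑ j ∈ Finset.range (t + 1),
      (t.choose j : ℂ) * (walkStep G V ^ (2 * (j : ℤ) - t).natAbs).1 (i, none) (u, none) := by
  set W := walkStep G V with hW
  -- The induction needs the whole column: its vanishing outside the flat subspace is what lets the
  -- action as `2P` be iterated.
  have h1 : ∀ t : ℕ, ∀ x : Coined N, ((W.1 + (W⁻¹).1) ^ t) x (u, none)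
      = if x.2 = none then 2 ^ t * ((transition G d ^ t) x.1 u : ℂ) else 0 := by
    intro t
    induction t with
    | zero =>
      intro x
      rw [pow_zero, pow_zero, pow_zero, one_apply, one_apply]
      obtain ⟨j, c⟩ := x
      cases c <;> simp
      split_ifs <;> simp
    | succ t ih =>
      intro x
      rw [pow_succ', mul_apply, Fintype.sum_prod_type]
      simp only [ih, Fintype.sum_option, Matrix.add_apply]
      have h2 := fun i => walkStep_add_inv_apply G V hd x i
      simp only [← hW] at h2
      simp only [h2, if_true, reduceCtorEq, if_false, mul_zero, Finset.sum_const_zero, add_zero]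
      by_cases hx : x.2 = none
      · simp only [hx, if_true, pow_succ' (transition G d), mul_apply]
        push_cast
        rw [Finset.mul_sum]
        exact Finset.sum_congr rfl fun k _ => by ring
      · simp [hx]
  have h3 : (W.1 + (W⁻¹).1) ^ t = ∑ j ∈ Finset.range (t + 1),
      (t.choose j : ℂ) • (W ^ (2 * (j : ℤ) - t)).1 := by
    have hc : Commute W.1 (W⁻¹).1 := by
      have := congrArg Subtype.val ((Commute.refl W).inv_right).eq
      exact this
    rw [hc.add_pow]
    refine Finset.sum_congr rfl fun j hj => ?_
    have hj' : j ≤ t := Nat.lt_succ_iff.1 (Finset.mem_range.1 hj)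
    have h4 : W ^ (2 * (j : ℤ) - t) = W ^ j * W⁻¹ ^ (t - j) := by
      rw [inv_pow, ← zpow_natCast, ← zpow_natCast, ← _root_.zpow_neg, ← _root_.zpow_add]
      congr 1
      push_cast [hj']
      ring
    rw [h4, Submonoid.coe_mul, SubmonoidClass.coe_pow, SubmonoidClass.coe_pow, ← Nat.cast_comm,
      ← nsmul_eq_mul, Nat.cast_smul_eq_nsmul]
  have h5 := h1 t (i, none)
  rw [if_pos rfl] at h5
  rw [← h5, h3, Matrix.sum_apply]
  refine Finset.sum_congr rfl fun j _ => ?_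
  rw [Matrix.smul_apply, smul_eq_mul, walkStep_zpow_natAbs]

end Spectrum

/-! ### The Chebyshev expansion and its truncation -/

section Chebyshev

theorem chebCoeff_nonneg (t l : ℕ) : 0 ≤ chebCoeff t l := by
  rw [chebCoeff]
  split_ifs <;> positivity

/-- `chebCoeff t l` is the binomial mass of the fibre `|2j - t| = l`: empty for the wrong parity,
one point for `l = 0`, two symmetric points otherwise. -/
theorem sum_choose_smul_natAbs {E : Type} [AddCommGroup E] [Module ℝ E] (t : ℕ) (f : ℕ → E) :
    ∑ j ∈ Finset.range (t + 1), ((t.choose j : ℝ) / 2 ^ t) • f (2 * (j : ℤ) - t).natAbs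
      = ∑ l ∈ Finset.range (t + 1), chebCoeff t l • f l := by
  rw [← Finset.sum_fiberwise_of_maps_to (s := Finset.range (t + 1)) (t := Finset.range (t + 1))
    (g := fun j => (2 * (j : ℤ) - t).natAbs) (by
      intro j hj
      rw [Finset.mem_range] at hj ⊢
      omega)]
  refine Finset.sum_congr rfl fun l hl => ?_
  rw [Finset.mem_range] at hl
  have h1 : ∀ j ∈ (Finset.range (t + 1)).filter fun j : ℕ => (2 * (j : ℤ) - t).natAbs = l,
      ((t.choose j : ℝ) / 2 ^ t) • f (2 * (j : ℤ) - t).natAbs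
        = ((t.choose j : ℝ) / 2 ^ t) • f l := by
    intro j hj
    rw [(Finset.mem_filter.1 hj).2]
  rw [Finset.sum_congr rfl h1, ← Finset.sum_smul]
  congr 1
  by_cases hp : l % 2 = t % 2
  · rw [chebCoeff, if_pos ⟨by omega, hp⟩]
    by_cases h0 : l = 0
    · have : (Finset.range (t + 1)).filter (fun j : ℕ => (2 * (j : ℤ) - t).natAbs = l)
          = {(t - l) / 2} := by
        ext j
        rw [Finset.mem_filter, Finset.mem_range, Finset.mem_singleton]
        omega
      rw [this, Finset.sum_singleton, if_pos h0, one_mul]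
    · have : (Finset.range (t + 1)).filter (fun j : ℕ => (2 * (j : ℤ) - t).natAbs = l)
          = {(t - l) / 2, (t + l) / 2} := by
        ext j
        rw [Finset.mem_filter, Finset.mem_range, Finset.mem_insert, Finset.mem_singleton]
        omega
      have hsymm : t.choose ((t + l) / 2) = t.choose ((t - l) / 2) := by
        rw [← Nat.choose_symm (by omega)]
        congr 1
        omega
      rw [this, Finset.sum_pair (by omega), if_neg h0, hsymm]
      ring
  · have : (Finset.range (t + 1)).filter (fun j : ℕ => (2 * (j : ℤ) - t).natAbs = l) = ∅ := by
      ext j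
      rw [Finset.mem_filter, Finset.mem_range]
      simp only [Finset.notMem_empty, iff_false]
      omega
    rw [this, Finset.sum_empty, chebCoeff, if_neg fun h => hp h.2]

theorem sum_chebCoeff (t : ℕ) : ∑ l ∈ Finset.range (t + 1), chebCoeff t l = 1 := by
  have h := sum_choose_smul_natAbs t fun _ => (1 : ℝ)
  simp only [smul_eq_mul, mul_one] at h
  rw [← h, ← Finset.sum_div]
  have : (∑ j ∈ Finset.range (t + 1), (t.choose j : ℝ)) = 2 ^ t := by
    exact_mod_cast Nat.sum_range_choose t
  rw [this, div_self (by positivity)]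

theorem sum_chebCoeff_smul_split {E : Type} [AddCommGroup E] [Module ℝ E] (t τ : ℕ) (f : ℕ → E) :
    ∑ l ∈ Finset.range (t + 1), chebCoeff t l • f l
      = ∑ l ∈ Finset.range (τ + 1), chebCoeff t l • f l
        + ∑ l ∈ Finset.Ioc τ t, chebCoeff t l • f l := by
  rcases le_or_gt τ t with h | h
  · have : Finset.Ioc τ t = Finset.Ico (τ + 1) (t + 1) := by
      ext l
      rw [Finset.mem_Ioc, Finset.mem_Ico]
      omega
    rw [this, Finset.sum_range_add_sum_Ico _ (by omega)]
  · rw [Finset.Ioc_eq_empty (by omega), Finset.sum_empty, add_zero]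
    refine Finset.sum_subset (Finset.range_mono (by omega)) fun l _ hl => ?_
    rw [Finset.mem_range] at hl
    rw [chebCoeff, if_neg (by omega), zero_smul]

theorem sum_range_chebCoeff (t τ : ℕ) : ∑ l ∈ Finset.range (τ + 1), chebCoeff t l
    = 1 - ∑ l ∈ Finset.Ioc τ t, chebCoeff t l := by
  have h := sum_chebCoeff_smul_split t τ fun _ => (1 : ℝ)
  simp only [smul_eq_mul, mul_one, sum_chebCoeff] at h
  rw [h, add_sub_cancel_right]

/-- Chernoff's bound: `exp(sτ) ≤ 2 cosh(sl)` for `l > τ`, the mean of `cosh(sl)` under these weights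
is `coshᵗ s`, and `cosh s ≤ exp(s²/2)`. -/
theorem sum_chebCoeff_tail_le {t : ℕ} (ht : t ≠ 0) (τ : ℕ) :
    ∑ l ∈ Finset.Ioc τ t, chebCoeff t l ≤ 2 * Real.exp (-((τ : ℝ) ^ 2 / (2 * t))) := by
  have ht0 : (0 : ℝ) < t := by exact_mod_cast Nat.pos_of_ne_zero ht
  -- The minimizer of `ts²/2 - sτ`.
  set s : ℝ := τ / t with hs
  have hs0 : 0 ≤ s := by positivity
  have hexp : ∀ s : ℝ, ∑ j ∈ Finset.range (t + 1), ((t.choose j : ℝ) / 2 ^ t)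
      * Real.exp (s * (2 * (j : ℤ) - t : ℤ)) = Real.cosh s ^ t := by
    intro s
    rw [Real.cosh_eq, div_pow, add_pow, Finset.sum_div]
    refine Finset.sum_congr rfl fun j hj => ?_
    have hj' : j ≤ t := Nat.lt_succ_iff.1 (Finset.mem_range.1 hj)
    rw [← Real.exp_nat_mul, ← Real.exp_nat_mul, ← Real.exp_add]
    have : (j : ℝ) * s + ((t - j : ℕ) : ℝ) * -s = s * (2 * (j : ℤ) - t : ℤ) := by
      push_cast [hj']
      ring
    rw [this]
    ring
  have hcosh : ∑ l ∈ Finset.range (t + 1), chebCoeff t l * (2 * Real.cosh (s * l))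
      = 2 * Real.cosh s ^ t := by
    have h := sum_choose_smul_natAbs t fun l => 2 * Real.cosh (s * l)
    simp only [smul_eq_mul] at h
    rw [← h]
    have h2 := hexp s
    have h3 := hexp (-s)
    rw [Real.cosh_neg] at h3
    rw [two_mul]
    nth_rw 1 [← h2]
    rw [← h3, ← Finset.sum_add_distrib]
    refine Finset.sum_congr rfl fun j _ => ?_
    rw [← mul_add, neg_mul, Nat.cast_natAbs, Int.cast_abs]
    congr 1
    rw [← Real.cosh_abs, abs_mul, abs_abs, ← abs_mul, Real.cosh_abs, Real.cosh_eq]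
    ring
  have h1 : (∑ l ∈ Finset.Ioc τ t, chebCoeff t l) * Real.exp (s * τ) ≤ 2 * Real.cosh s ^ t := by
    rw [← hcosh, Finset.sum_mul]
    calc _ ≤ ∑ l ∈ Finset.Ioc τ t, chebCoeff t l * (2 * Real.cosh (s * l)) := by
          refine Finset.sum_le_sum fun l hl => mul_le_mul_of_nonneg_left ?_ (chebCoeff_nonneg _ _)
          have h4 : (τ : ℝ) ≤ l := by exact_mod_cast (Finset.mem_Ioc.1 hl).1.le
          rw [Real.cosh_eq]
          have := Real.exp_pos (-(s * l))
          have : Real.exp (s * τ) ≤ Real.exp (s * l) :=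
            Real.exp_le_exp.2 (mul_le_mul_of_nonneg_left h4 hs0)
          linarith
      _ ≤ _ := by
          refine Finset.sum_le_sum_of_subset_of_nonneg (fun l hl => ?_) fun l _ _ => ?_
          · rw [Finset.mem_Ioc] at hl
            rw [Finset.mem_range]
            omega
          · exact mul_nonneg (chebCoeff_nonneg _ _) (by have := Real.cosh_pos (s * l); positivity)
  have h2 : Real.cosh s ^ t ≤ Real.exp (t * (s ^ 2 / 2)) := by
    rw [Real.exp_nat_mul]
    exact pow_le_pow_left₀ (Real.cosh_pos s).le (Real.cosh_le_exp_half_sq s) t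
  have h3 : ∑ l ∈ Finset.Ioc τ t, chebCoeff t l
      ≤ 2 * Real.exp (t * (s ^ 2 / 2)) * Real.exp (-(s * τ)) := by
    rw [Real.exp_neg, ← div_eq_mul_inv, le_div_iff₀ (Real.exp_pos _)]
    linarith
  refine h3.trans_eq ?_
  rw [mul_assoc, ← Real.exp_add]
  congr 2
  rw [hs]
  field_simp
  ring

/-- The dropped terms have total weight `β`, and renormalization redistributes exactly `β` over the
kept ones. -/
theorem norm_sum_truncCoeff_smul_sub_le {E : Type} [NormedAddCommGroup E] [NormedSpace ℝ E]
    (t τ : ℕ) (h : ∑ l ∈ Finset.Ioc τ t, chebCoeff t l < 1) (v : ℕ → E) (hv : ∀ l, ‖v l‖ ≤ 1) :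
    ‖∑ l ∈ Finset.range (τ + 1), truncCoeff t τ l • v l
      - ∑ l ∈ Finset.range (t + 1), chebCoeff t l • v l‖
      ≤ 2 * ∑ l ∈ Finset.Ioc τ t, chebCoeff t l := by
  set β := ∑ l ∈ Finset.Ioc τ t, chebCoeff t l with hβ
  have hβ0 : 0 ≤ β := Finset.sum_nonneg fun l _ => chebCoeff_nonneg _ _
  have h1 : 0 < 1 - β := by linarith
  have hdiff : ∀ l, truncCoeff t τ l - chebCoeff t l = chebCoeff t l * (β / (1 - β)) := by
    intro l
    rw [truncCoeff, ← hβ]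
    field_simp
    ring
  have hbound : ∀ (s : Finset ℕ) (c : ℕ → ℝ), (∀ l, 0 ≤ c l) →
      ‖∑ l ∈ s, c l • v l‖ ≤ ∑ l ∈ s, c l := by
    intro s c hc
    refine (norm_sum_le _ _).trans (Finset.sum_le_sum fun l _ => ?_)
    rw [norm_smul, Real.norm_of_nonneg (hc l)]
    exact mul_le_of_le_one_right (hc l) (hv l)
  rw [sum_chebCoeff_smul_split t τ, ← sub_sub, ← Finset.sum_sub_distrib]
  simp only [← sub_smul, hdiff]
  refine (norm_sub_le _ _).trans ?_
  have h2 := hbound (Finset.range (τ + 1)) (fun l => chebCoeff t l * (β / (1 - β)))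
    fun l => mul_nonneg (chebCoeff_nonneg _ _) (by positivity)
  have h3 := hbound (Finset.Ioc τ t) (chebCoeff t) (chebCoeff_nonneg t)
  rw [← Finset.sum_mul, sum_range_chebCoeff, ← hβ, mul_div_cancel₀ _ h1.ne'] at h2
  linarith

/-- For a unit `ψ` one has `‖w‖² = 2 w i₀`. If this vanishes, then `w = 0` and `ψ` is the basis
vector itself, consistent with the convention for division by zero. -/
theorem householder_apply_self {ι : Type} [Fintype ι] [DecidableEq ι] (i₀ : ι) (ψ : ι → ℝ)
    (hψ : ∑ i, ψ i ^ 2 = 1) (i : ι) : (householder i₀ ψ).1 i i₀ = (ψ i : ℂ) := by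
  change ((_ : ℝ) : ℂ) = _
  congr 1
  set w : ι → ℝ := fun k => (if k = i₀ then 1 else 0) - ψ k with hw
  have hs : ∑ k, w k ^ 2 = 2 * w i₀ := by
    have : ∀ k, w k ^ 2 = (if k = i₀ then 1 - 2 * ψ k else 0) + ψ k ^ 2 := by
      intro k
      simp only [hw]
      split_ifs <;> ring
    rw [Finset.sum_congr rfl fun k _ => this k, Finset.sum_add_distrib, hψ]
    simp [hw]
    ring
  change (if i = i₀ then (1 : ℝ) else 0) - 2 * w i * w i₀ / ∑ k, w k ^ 2 = _
  by_cases h0 : w i₀ = 0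
  · rw [h0, mul_zero] at hs
    have := (Finset.sum_eq_zero_iff_of_nonneg fun k _ => sq_nonneg (w k)).1 hs i (Finset.mem_univ i)
    have h1 : w i = 0 := by simpa using this
    rw [h1]
    simp only [hw] at h1
    simp
    linarith
  · rw [hs]
    have : 2 * w i * w i₀ / (2 * w i₀) = w i := by field_simp
    rw [this]
    simp [hw]

end Chebyshev

/-! ### The norm estimated by amplitude estimation -/

section Norm

variable {N : ℕ} (t τ : ℕ) (u : Fin N)

theorem fastForwardUnitary_apply (W : unitaryGroup (Coined N) ℂ)
    (h : ∑ l ∈ Finset.Ioc τ t, chebCoeff t l < 1) (i : Fin N) :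
    (fastForwardUnitary W t τ).1 ((i, none), 0) ((u, none), 0)
      = ∑ l ∈ Finset.range (τ + 1),
        (truncCoeff t τ l : ℂ) * (W ^ l).1 (i, none) (u, none) := by
  have hq0 : ∀ l, 0 ≤ truncCoeff t τ l := fun l =>
    div_nonneg (chebCoeff_nonneg _ _) (by linarith)
  have hcol := householder_apply_self 0 (fun l : Fin (τ + 1) => Real.sqrt (truncCoeff t τ l)) (by
    simp only [Real.sq_sqrt (hq0 _)]
    rw [← Finset.sum_range (truncCoeff t τ)]
    simp only [truncCoeff]
    rw [← Finset.sum_div, sum_range_chebCoeff, div_self (by linarith)])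
  have h2 := conj_tensor_one_select_apply (fun l : Fin (τ + 1) => W ^ (l : ℕ))
    (householder 0 fun l : Fin (τ + 1) => Real.sqrt (truncCoeff t τ l)) (i, none) (u, none) 0 0
  rw [fastForwardUnitary, mul_assoc, h2, Finset.sum_range]
  refine Finset.sum_congr rfl fun l _ => ?_
  rw [hcol, Complex.conj_ofReal, ← Complex.ofReal_mul, Real.mul_self_sqrt (hq0 _)]

/-- The flat part of `Wˡ |u, flat⟩`. -/
def flatPart (W : unitaryGroup (Coined N) ℂ) (l : ℕ) : EuclideanSpace ℂ (Fin N) :=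
  WithLp.toLp 2 fun i => (W ^ l).1 (i, none) (u, none)

theorem norm_flatPart_le (W : unitaryGroup (Coined N) ℂ) (l : ℕ) : ‖flatPart u W l‖ ≤ 1 := by
  rw [EuclideanSpace.norm_eq]
  refine Real.sqrt_le_one.2 (le_trans ?_ (sum_normSq_col (W ^ l) (u, none)).le)
  rw [Fintype.sum_prod_type]
  refine Finset.sum_le_sum fun i _ => ?_
  rw [Fintype.sum_option]
  exact le_add_of_nonneg_right (Finset.sum_nonneg fun _ _ => by positivity)

variable (G : SimpleGraph (Fin N)) [DecidableRel G.Adj] {d : ℕ}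

theorem walkNorm_nonneg (P : Matrix (Fin N) (Fin N) ℝ) : 0 ≤ walkNorm P t u := norm_nonneg _

theorem walkNorm_sq (P : Matrix (Fin N) (Fin N) ℝ) : walkNorm P t u ^ 2 = ∑ i, (P ^ t) i u ^ 2 := by
  rw [walkNorm, EuclideanSpace.norm_sq_eq]
  simp

theorem walkNorm_eq (hd : ∀ v, G.degree v ≤ d) (V : CoinToss (transition G d)) :
    walkNorm (transition G d) t u
      = ‖∑ l ∈ Finset.range (t + 1), chebCoeff t l • flatPart u (walkStep G V) l‖ := by
  have h : ∑ l ∈ Finset.range (t + 1), chebCoeff t l • flatPart u (walkStep G V) l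
      = WithLp.toLp 2 fun i => ((transition G d ^ t) i u : ℂ) := by
    rw [← sum_choose_smul_natAbs]
    ext i
    have h1 := two_pow_mul_transition_pow G V hd t i u
    have h2 : ((transition G d ^ t) i u : ℂ) = ∑ j ∈ Finset.range (t + 1),
        ((((t.choose j : ℝ) / 2 ^ t : ℝ)) : ℂ) *
          (walkStep G V ^ (2 * (j : ℤ) - t).natAbs).1 (i, none) (u, none) := by
      rw [← mul_right_inj' (pow_ne_zero t (two_ne_zero (α := ℂ))), h1, Finset.mul_sum]
      refine Finset.sum_congr rfl fun j _ => ?_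
      push_cast
      field_simp
    rw [WithLp.ofLp_sum, Finset.sum_apply]
    simp only [h2]
    refine Finset.sum_congr rfl fun j _ => ?_
    rw [WithLp.ofLp_smul, Pi.smul_apply, Complex.real_smul]
    rfl
  rw [h, ← sq_eq_sq₀ (walkNorm_nonneg t u _) (norm_nonneg _), walkNorm_sq, EuclideanSpace.norm_sq_eq]
  simp

theorem walkNorm_le_one (hd : ∀ v, G.degree v ≤ d) (V : CoinToss (transition G d)) :
    walkNorm (transition G d) t u ≤ 1 := by
  rw [walkNorm_eq t u G hd V, ← sum_chebCoeff t]
  refine (norm_sum_le _ _).trans (Finset.sum_le_sum fun l _ => ?_)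
  rw [norm_smul, Real.norm_of_nonneg (chebCoeff_nonneg _ _)]
  exact mul_le_of_le_one_right (chebCoeff_nonneg _ _) (norm_flatPart_le u _ l)

/-- Cauchy–Schwarz for a vector whose entries sum to 1. This replaces an a priori lower bound on the
norm. -/
theorem one_le_sqrt_mul_walkNorm : 1 ≤ Real.sqrt N * walkNorm (transition G d) t u := by
  rw [← one_le_sq_iff₀ (mul_nonneg (Real.sqrt_nonneg _) (walkNorm_nonneg t u _)), mul_pow,
    Real.sq_sqrt (by positivity), walkNorm_sq]
  have := sq_sum_le_card_mul_sum_sq (s := Finset.univ) (f := fun i => (transition G d ^ t) i u)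
  rw [sum_transition_pow, Finset.card_univ, Fintype.card_fin] at this
  simpa using this

/-- With the truncation of the additive estimator, the norm of the flat part is within `η / 2`
of the norm of the distribution of the random walk. -/
theorem exists_flat_norm (hd : ∀ v, G.degree v ≤ d) (V : CoinToss (transition G d)) {η : ℝ}
    (hη : 0 < η) (hη1 : η < 1)
    (hτ : Real.sqrt (2 * t * Real.log (8 * Real.sqrt N / η)) ≤ τ) :
    ∃ a : ℝ, 0 ≤ a ∧ a ^ 2 = ∑ i, ‖(fastForwardUnitary (walkStep G V) t τ).1
      ((i, none), 0) ((u, none), 0)‖ ^ 2 ∧ |a - walkNorm (transition G d) t u| ≤ η / 2 := by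
  have hN : 1 ≤ Real.sqrt N := by
    rw [Real.one_le_sqrt]
    exact_mod_cast u.pos
  -- The choice of `τ` gives a tail of at most `2η/(8√N) ≤ η/4`; renormalization doubles it to
  -- `η/2`.
  have hβ : ∑ l ∈ Finset.Ioc τ t, chebCoeff t l ≤ η / 4 := by
    rcases eq_or_ne t 0 with rfl | ht
    · simp only [Finset.Ioc_eq_empty (a := τ) (b := 0) (by omega), Finset.sum_empty]
      positivity
    · have ht0 : (0 : ℝ) < t := by exact_mod_cast Nat.pos_of_ne_zero ht
      refine (sum_chebCoeff_tail_le ht τ).trans ?_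
      have h1 : 2 * t * Real.log (8 * Real.sqrt N / η) ≤ (τ : ℝ) ^ 2 :=
        (Real.sqrt_le_left (by positivity)).1 hτ
      have h2 : Real.log (8 * Real.sqrt N / η) ≤ (τ : ℝ) ^ 2 / (2 * t) := by
        rw [le_div_iff₀ (by positivity)]
        linarith
      have h3 : Real.exp (-((τ : ℝ) ^ 2 / (2 * t))) ≤ η / (8 * Real.sqrt N) := by
        calc _ ≤ Real.exp (-Real.log (8 * Real.sqrt N / η)) := Real.exp_le_exp.2 (by linarith)
          _ = _ := by
            rw [← Real.log_inv, Real.exp_log (by positivity), inv_div]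
      have h4 : η / (8 * Real.sqrt N) ≤ η / 8 := by
        apply div_le_div_of_nonneg_left hη.le (by norm_num)
        linarith
      linarith
  have hβ1 : ∑ l ∈ Finset.Ioc τ t, chebCoeff t l < 1 := by linarith
  refine ⟨‖∑ l ∈ Finset.range (τ + 1), truncCoeff t τ l • flatPart u (walkStep G V) l‖,
    norm_nonneg _, ?_, ?_⟩
  · rw [EuclideanSpace.norm_sq_eq]
    refine Finset.sum_congr rfl fun i _ => ?_
    rw [fastForwardUnitary_apply t τ u _ hβ1, WithLp.ofLp_sum, Finset.sum_apply]
    congr 2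
  · rw [walkNorm_eq t u G hd V]
    refine (abs_norm_sub_norm_le _ _).trans ?_
    refine (norm_sum_truncCoeff_smul_sub_le t τ hβ1 _ (norm_flatPart_le u _)).trans ?_
    linarith

end Norm

/-! ### The additive estimator -/

section Additive

variable {N : ℕ} (t : ℕ) (u : Fin N)

theorem indicator_compl_mono {s s' : Set ℝ} (h : s ⊆ s') (a : ℝ) :
    s'ᶜ.indicator (1 : ℝ → ℝ≥0∞) a ≤ sᶜ.indicator 1 a :=
  Set.indicator_le_indicator_of_subset (Set.compl_subset_compl.2 h) (fun _ => zero_le) a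

theorem all_estimateOnce (τ m : ℕ) : (estimateOnce t τ m u).All fun a => 0 ≤ a ∧ a ≤ 1 := by
  intro z
  refine ⟨Real.sin_nonneg_of_nonneg_of_le_pi (by positivity) ?_, Real.sin_le_one _⟩
  rw [div_le_iff₀ (by positivity)]
  have : ((z.2.2 : ℕ) : ℝ) ≤ m + 1 := by exact_mod_cast z.2.2.2.le
  exact mul_le_mul_of_nonneg_left this Real.pi_pos.le

theorem all_normEstimator (η δ : ℝ) : (normEstimator t u η δ).All fun a => 0 ≤ a ∧ a ≤ 1 := by
  refine Prog.all_bind (Prog.all_iterate (all_estimateOnce t u _ _) _) fun l hl => ?_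
  rcases pick_mem (η / 2 / 3) l with h | h
  · change 0 ≤ pick _ l ∧ pick _ l ≤ 1
    rw [h]
    norm_num
  · exact hl.2 _ h

variable (G : SimpleGraph (Fin N)) [DecidableRel G.Adj] {d : ℕ}

/-- The additive estimator is correct. -/
theorem mean_normEstimator_le (hd : ∀ v, G.degree v ≤ d) (V : CoinToss (transition G d)) {η δ : ℝ}
    (hη : 0 < η) (hδ : 0 < δ) (hδ1 : δ < 1) :
    (normEstimator t u η δ).mean (walkStep G V)
      ({b | |b - walkNorm (transition G d) t u| ≤ η}ᶜ.indicator 1) ≤ ENNReal.ofReal δ := by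
  -- For `η ≥ 1` any number in `[0, 1]` is accurate enough. Otherwise the tail is below 1 and the
  -- normalization is legitimate.
  rcases le_or_gt 1 η with h1 | h1
  · have h0 := walkNorm_nonneg t u (transition G d)
    have hp := walkNorm_le_one t u G hd V
    refine (Prog.mean_mono_of_all (h := fun _ => 0) _ (all_normEstimator t u η δ)
      fun a ha => ?_).trans ((Prog.mean_const _ _ _).le.trans zero_le)
    have : |a - walkNorm (transition G d) t u| ≤ η := by
      rw [abs_le]
      constructor <;> linarith [ha.1, ha.2]
    simp [this]
  · obtain ⟨a, ha0, ha, hclose⟩ := exists_flat_norm t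
      ⌈Real.sqrt (2 * t * Real.log (8 * Real.sqrt N / η))⌉₊ u G hd V hη h1 (Nat.le_ceil _)
    have hm : 4 * Real.pi / ((⌈4 * Real.pi / (η / 2 / 3)⌉₊ + 1 : ℕ) : ℝ) ≤ η / 2 / 3 := by
      rw [div_le_iff₀ (by positivity), ← div_le_iff₀' (by positivity)]
      push_cast
      exact (Nat.le_ceil _).trans (by linarith)
    have hlog : 0 < Real.log (1 / δ) := Real.log_pos (by rwa [lt_div_iff₀ hδ, one_mul])
    have hn : ⌈18 * Real.log (1 / δ)⌉₊ ≠ 0 := (Nat.ceil_pos.2 (by positivity)).ne'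
    have key := Prog.mean_pick_iterate_le (walkStep G V) _
      (mean_estimateOnce_le (walkStep G V) t _ _ u ha0 ha hm) hn
    refine le_trans (Prog.mean_mono _ (indicator_compl_mono fun b hb => ?_))
      (key.trans (ENNReal.ofReal_le_ofReal ?_))
    -- Half of `η` pays for amplitude estimation, half for truncation.
    · have hb' : |b - a| ≤ 3 * (η / 2 / 3) := hb
      change |b - _| ≤ η
      rw [show b - walkNorm (transition G d) t u = (b - a) + (a - walkNorm (transition G d) t u)
        by ring]
      refine (abs_add_le _ _).trans ?_
      linarith
    · have h2 : Real.log (1 / δ) ≤ (⌈18 * Real.log (1 / δ)⌉₊ : ℝ) / 18 := by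
        rw [le_div_iff₀ (by norm_num), mul_comm]
        exact Nat.le_ceil _
      calc _ ≤ Real.exp (-Real.log (1 / δ)) := Real.exp_le_exp.2 (by linarith)
        _ = δ := by rw [← Real.log_inv, Real.exp_log (by positivity), one_div, inv_inv]

theorem steps_append {X A : Type} [Fintype X] [DecidableEq X] [Fintype A] [DecidableEq A]
    (c c' : Circuit X A) : Circuit.steps (c ++ c') = Circuit.steps c + Circuit.steps c' := by
  simp [Circuit.steps]

theorem steps_cons {X A : Type} [Fintype X] [DecidableEq X] [Fintype A] [DecidableEq A]
    (g : Gate X A) (c : Circuit X A) : Circuit.steps (g :: c) = g.steps + Circuit.steps c := by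
  simp [Circuit.steps]

/-- One preparation of `ψ`, and two uses of fast-forwarding in each of the `m` Grover iterations. -/
theorem steps_estimationCircuit (τ m : ℕ) :
    Circuit.steps (estimationCircuit t τ m u) = τ * (2 * m + 1) := by
  have h1 : Circuit.steps (fastForward N t τ m) = τ := by
    simp [fastForward, Circuit.steps, Gate.steps, Function.comp_def]
  have h2 : Circuit.steps (fastForwardInv N t τ m) = τ := by
    simp [fastForwardInv, Circuit.steps, Gate.steps, Function.comp_def]
  have h3 : ∀ i, Circuit.steps (grover t τ m u i) = 2 * τ := by
    intro i
    rw [grover, steps_append, steps_cons, steps_cons, h1, h2, Gate.steps, Gate.steps]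
    ring
  have h4 : ∀ n, Circuit.steps ((List.range n).flatMap (grover t τ m u)) = n * (2 * τ) := by
    intro n
    induction n with
    | zero => simp [Circuit.steps]
    | succ n ih =>
      rw [List.range_succ, List.flatMap_append, steps_append, ih, List.flatMap_singleton, h3]
      ring
  rw [estimationCircuit, steps_append, steps_append, steps_cons, steps_cons, h1, h4]
  simp only [Gate.steps, Circuit.steps, List.map_nil, List.sum_nil]
  ring

theorem cost_normEstimator (W : unitaryGroup (Coined N) ℂ) (η δ : ℝ) :
    (normEstimator t u η δ).cost W = ((⌈18 * Real.log (1 / δ)⌉₊ *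
      (⌈Real.sqrt (2 * t * Real.log (8 * Real.sqrt N / η))⌉₊ *
        (2 * ⌈4 * Real.pi / (η / 2 / 3)⌉₊ + 1)) : ℕ) : ℝ≥0∞) := by
  rw [normEstimator, amplitudeEstimation, Prog.cost_bind_ret, Prog.cost_iterate, estimateOnce,
    Prog.cost_run]
  simp only [Prog.cost_ret, expect_const, add_zero]
  rw [steps_estimationCircuit, ← Nat.cast_mul]

end Additive

/-! ### The multiplicative estimator -/

section Multiplicative

variable {N : ℕ} (t : ℕ) (u : Fin N) (G : SimpleGraph (Fin N)) [DecidableRel G.Adj] {d : ℕ}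

theorem sqrt_le_two_pow_numIter (hN : 0 < N) : Real.sqrt N ≤ 2 ^ numIter N := by
  have hN0 : (0 : ℝ) < N := by exact_mod_cast hN
  have h : Real.logb 2 N / 2 ≤ numIter N := Nat.le_ceil _
  calc Real.sqrt N = (2 : ℝ) ^ (Real.logb 2 N / 2) := by
        rw [Real.sqrt_eq_rpow, div_eq_mul_one_div (Real.logb 2 N), Real.rpow_mul (by norm_num),
          Real.rpow_logb (by norm_num) (by norm_num) hN0]
    _ ≤ (2 : ℝ) ^ (numIter N : ℝ) := Real.rpow_le_rpow_of_exponent_le (by norm_num) h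
    _ = _ := Real.rpow_natCast _ _

theorem numIter_lt (hN : 1 ≤ N) : (numIter N : ℝ) < Real.logb 2 N / 2 + 1 := by
  have : 0 ≤ Real.logb 2 N := Real.logb_nonneg (by norm_num) (by exact_mod_cast hN)
  exact Nat.ceil_lt_add_one (by positivity)

theorem two_pow_numIter_le (hN : 1 ≤ N) : (2 : ℝ) ^ numIter N ≤ 2 * Real.sqrt N := by
  have hN0 : (0 : ℝ) < N := by exact_mod_cast hN
  calc (2 : ℝ) ^ numIter N = (2 : ℝ) ^ (numIter N : ℝ) := (Real.rpow_natCast _ _).symm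
    _ ≤ (2 : ℝ) ^ (Real.logb 2 N / 2 + 1) :=
        Real.rpow_le_rpow_of_exponent_le (by norm_num) (numIter_lt hN).le
    _ = 2 * Real.sqrt N := by
        rw [Real.rpow_add (by norm_num), Real.rpow_one, Real.sqrt_eq_rpow,
          div_eq_mul_one_div (Real.logb 2 N), Real.rpow_mul (by norm_num),
          Real.rpow_logb (by norm_num) (by norm_num) hN0, mul_comm]

theorem numIter_pos (hN : 2 ≤ N) : 0 < numIter N := by
  have : 0 < Real.logb 2 N := Real.logb_pos (by norm_num) (by exact_mod_cast hN)
  exact Nat.ceil_pos.2 (by positivity)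

/-- Each iteration adds `δ'` to the failure probability. When the estimate is accurate, the loop
either returns a correct value or passes on to the remaining iterations; the pending estimate `a`
matters only if none remain. -/
theorem mean_multLoop_le (hd : ∀ v, G.degree v ≤ d) (V : CoinToss (transition G d)) {ε δ' : ℝ}
    (hε : 0 < ε) (hδ : 0 < δ') (hδ1 : δ' < 1) (n k : ℕ) (a : ℝ) (hkn : k + n = numIter N + 1)
    (ha : n = 0 → |walkNorm (transition G d) t u - a| ≤ ε * walkNorm (transition G d) t u) :
    (multLoop t u ε δ' n k a).mean (walkStep G V)
      ({b | |walkNorm (transition G d) t u - b| ≤ ε * walkNorm (transition G d) t u}ᶜ.indicator 1)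
      ≤ n * ENNReal.ofReal δ' := by
  set p := walkNorm (transition G d) t u with hp
  induction n generalizing k a with
  | zero =>
    rw [multLoop, Prog.mean_ret]
    simp [ha rfl]
  | succ n ih =>
    have hest := mean_normEstimator_le t u G hd V (η := ε * 2⁻¹ ^ (k + 2)) (by positivity) hδ hδ1
    rw [← hp] at hest
    rw [multLoop, Prog.mean_bind]
    refine (Prog.mean_mono _ (h := fun b => {b | |b - p| ≤ ε * 2⁻¹ ^ (k + 2)}ᶜ.indicator 1 b
      + n * ENNReal.ofReal δ') fun b => ?_).trans ?_
    · by_cases hb : |b - p| ≤ ε * 2⁻¹ ^ (k + 2)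
      · have hε' : ε * (2⁻¹ : ℝ) ^ (k + 2) = ε * 2⁻¹ ^ k / 4 := by
          rw [pow_add]
          ring
        have hk0 : (0 : ℝ) < 2⁻¹ ^ k := by positivity
        have hεk : 0 < ε * (2⁻¹ : ℝ) ^ k := by positivity
        rw [hε'] at hb
        split_ifs with hexit
        · rw [Prog.mean_ret]
          have : |p - b| ≤ ε * p := by
            rw [abs_sub_comm]
            refine hb.trans ?_
            have h1 := (abs_le.1 hb).2
            -- The margin `ε2⁻ᵏ` in the exit test exceeds the error `ε2⁻ᵏ/4`, so exiting certifies
            -- this bound.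
            have h2 : (2⁻¹ : ℝ) ^ k ≤ p := by
              have : b ≥ 2⁻¹ ^ k + ε * 2⁻¹ ^ k := by linarith
              linarith
            have := mul_le_mul_of_nonneg_left h2 hε.le
            linarith
          simp [this]
        · refine (ih (k + 1) b (by omega) fun hn => ?_).trans le_add_self
          rw [abs_sub_comm]
          refine hb.trans ?_
          -- In the last iteration the bound comes from `2⁻ᵀ ≤ 1/√N ≤ p`, without any test.
          have h2 : (2⁻¹ : ℝ) ^ k ≤ p := by
            have hkT : k = numIter N := by omega
            rw [hkT, inv_pow, inv_le_iff_one_le_mul₀ (by positivity)]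
            have h3 := one_le_sqrt_mul_walkNorm t u G (d := d)
            have h4 := sqrt_le_two_pow_numIter u.pos
            rw [← hp] at h3
            exact h3.trans ((mul_le_mul_of_nonneg_right h4 (walkNorm_nonneg _ _ _)).trans_eq
              (mul_comm _ _))
          have := mul_le_mul_of_nonneg_left h2 hε.le
          linarith
      · have h1 : ({b | |b - p| ≤ ε * 2⁻¹ ^ (k + 2)}ᶜ.indicator 1 b : ℝ≥0∞) = 1 :=
          Set.indicator_of_mem (show b ∈ _ᶜ from hb) _
        rw [h1]
        refine le_add_right (le_trans (Prog.mean_mono _ (h := fun _ => 1) fun c => ?_)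
          (Prog.mean_const _ _ _).le)
        exact Set.indicator_le_self' (fun _ _ => zero_le) c
    · rw [Prog.mean_add, Prog.mean_const]
      push_cast
      rw [add_mul, one_mul, add_comm]
      gcongr

variable {B : ℝ} {ε δ' : ℝ}

theorem cost_multLoop_zero (W : unitaryGroup (Coined N) ℂ) (k : ℕ) (a : ℝ) :
    (multLoop t u ε δ' 0 k a).cost W = 0 := by
  rw [multLoop, Prog.cost_ret]

/-- Once the threshold is far below the norm, the loop is left in each iteration with high
probability. -/
theorem cost_multLoop_le_of_four_le (hd : ∀ v, G.degree v ≤ d) (V : CoinToss (transition G d))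
    (hB : 0 ≤ B) (hε : 0 < ε) (hε1 : ε ≤ 1) (hδ : 0 < δ') (hδ1 : δ' < 1)
    (hδ4 : 2 ≤ numIter N → δ' ≤ 1 / 4)
    (hcost : ∀ k, k ≤ numIter N → (normEstimator t u (ε * 2⁻¹ ^ (k + 2)) δ').cost (walkStep G V)
      ≤ ENNReal.ofReal (B * 2 ^ k))
    (n k : ℕ) (a : ℝ) (hk : 1 ≤ k) (hkn : k + n = numIter N + 1)
    (h4 : 4 ≤ 2 ^ k * walkNorm (transition G d) t u) :
    (multLoop t u ε δ' n k a).cost (walkStep G V) ≤ ENNReal.ofReal (2 * B * 2 ^ k) := by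
  set p := walkNorm (transition G d) t u with hp
  induction n generalizing k a with
  | zero =>
    rw [cost_multLoop_zero]
    exact zero_le
  | succ n ih =>
    have hest := mean_normEstimator_le t u G hd V (η := ε * 2⁻¹ ^ (k + 2)) (by positivity) hδ hδ1
    rw [← hp] at hest
    have hk2 : (0 : ℝ) < 2 ^ k := by positivity
    rw [multLoop, Prog.cost_bind]
    have hrest : ((normEstimator t u (ε * 2⁻¹ ^ (k + 2)) δ').mean (walkStep G V) fun b =>
        (if b ≥ (1 + ε) * 2⁻¹ ^ k then .ret b else multLoop t u ε δ' n (k + 1) b :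
          Prog (Coined N) ℝ).cost (walkStep G V)) ≤ ENNReal.ofReal (B * 2 ^ k) := by
      -- With no iteration left nothing more is spent. Otherwise at least two iterations exist in
      -- total, so `δ' ≤ 1/4` is available.
      rcases Nat.eq_zero_or_pos n with rfl | hn
      · refine (Prog.mean_mono _ (h := fun _ => 0) fun b => ?_).trans
          ((Prog.mean_const _ _ _).le.trans zero_le)
        split_ifs
        · rw [Prog.cost_ret]
        · rw [cost_multLoop_zero]
      · refine (Prog.mean_mono _ (h := fun b => ENNReal.ofReal (2 * B * 2 ^ (k + 1)) *
          {b | |b - p| ≤ ε * 2⁻¹ ^ (k + 2)}ᶜ.indicator 1 b) fun b => ?_).trans ?_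
        · split_ifs with hexit
          · rw [Prog.cost_ret]
            exact zero_le
          · have hb : ¬ |b - p| ≤ ε * 2⁻¹ ^ (k + 2) := by
              intro hb
              apply hexit
              have h1 := (abs_le.1 hb).1
              have hk0 : (0 : ℝ) < 2⁻¹ ^ k := by positivity
              -- An accurate estimate is then at least `(4 - ε/4)2⁻ᵏ`, which exceeds `(1 + ε)2⁻ᵏ`
              -- because `ε ≤ 1`. Continuing therefore requires a failed estimate.
              have h2 : 4 * (2⁻¹ : ℝ) ^ k ≤ p := by
                rw [inv_pow, ← div_eq_mul_inv, div_le_iff₀ hk2]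
                linarith
              rw [pow_add] at h1
              nlinarith
            have h1 : ({b | |b - p| ≤ ε * 2⁻¹ ^ (k + 2)}ᶜ.indicator 1 b : ℝ≥0∞) = 1 :=
              Set.indicator_of_mem (show b ∈ _ᶜ from hb) _
            rw [h1, mul_one]
            refine ih (k + 1) b (by omega) (by omega) ?_
            rw [pow_succ]
            linarith
        · rw [Prog.mean_const_mul]
          calc _ ≤ ENNReal.ofReal (2 * B * 2 ^ (k + 1)) * ENNReal.ofReal δ' := by gcongr
            _ = ENNReal.ofReal (2 * B * 2 ^ (k + 1) * δ') :=
                (ENNReal.ofReal_mul (by positivity)).symm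
            _ ≤ _ := by
                apply ENNReal.ofReal_le_ofReal
                have h3 := hδ4 (by omega)
                have h5 : 0 ≤ B * 2 ^ k := by positivity
                rw [pow_succ]
                nlinarith
    calc _ ≤ ENNReal.ofReal (B * 2 ^ k) + ENNReal.ofReal (B * 2 ^ k) :=
          add_le_add (hcost k (by omega)) hrest
      _ = _ := by
          rw [← ENNReal.ofReal_add (by positivity) (by positivity)]
          congr 1
          ring

/-- The subtracted `B·2ᵏ` makes the bound a potential that drops by exactly the cost of iteration
`k` when `k` increases. -/
theorem cost_multLoop_le (hd : ∀ v, G.degree v ≤ d) (V : CoinToss (transition G d))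
    (hB : 0 ≤ B) (hε : 0 < ε) (hε1 : ε ≤ 1) (hδ : 0 < δ') (hδ1 : δ' < 1)
    (hδ4 : 2 ≤ numIter N → δ' ≤ 1 / 4)
    (hcost : ∀ k, k ≤ numIter N → (normEstimator t u (ε * 2⁻¹ ^ (k + 2)) δ').cost (walkStep G V)
      ≤ ENNReal.ofReal (B * 2 ^ k))
    (hp0 : 0 < walkNorm (transition G d) t u)
    (n k : ℕ) (a : ℝ) (hk : 1 ≤ k) (hkn : k + n = numIter N + 1)
    (h4 : 2 ^ k * walkNorm (transition G d) t u < 4) :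
    (multLoop t u ε δ' n k a).cost (walkStep G V)
      ≤ ENNReal.ofReal (24 * B / walkNorm (transition G d) t u - B * 2 ^ k) := by
  set p := walkNorm (transition G d) t u with hp
  induction n generalizing k a with
  | zero =>
    rw [cost_multLoop_zero]
    exact zero_le
  | succ n ih =>
    -- The constant 24 is fixed by the crossing of `2ᵏp = 4`: the later phase costs `2B·2^(k+1) =
    -- 4B·2ᵏ`, and the potential after this iteration is `24B/p - 2B·2ᵏ`.
    have h6 : 6 * (B * 2 ^ k) ≤ 24 * B / p := by
      rw [le_div_iff₀ hp0]
      nlinarith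
    have h0 : 0 ≤ B * 2 ^ k := by positivity
    have hsucc : B * (2 : ℝ) ^ (k + 1) = 2 * (B * 2 ^ k) := by ring
    rw [multLoop, Prog.cost_bind]
    have hrest : ∀ b, (if b ≥ (1 + ε) * 2⁻¹ ^ k then .ret b else multLoop t u ε δ' n (k + 1) b :
          Prog (Coined N) ℝ).cost (walkStep G V)
        ≤ ENNReal.ofReal (24 * B / p - 2 * (B * 2 ^ k)) := by
      intro b
      split_ifs
      · rw [Prog.cost_ret]
        exact zero_le
      · rcases lt_or_ge (2 ^ (k + 1) * p) 4 with h | h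
        · rw [← hsucc]
          exact ih (k + 1) b (by omega) (by omega) h
        · refine (cost_multLoop_le_of_four_le t u G hd V hB hε hε1 hδ hδ1 hδ4 hcost n (k + 1) b
            (by omega) (by omega) h).trans (ENNReal.ofReal_le_ofReal ?_)
          rw [mul_assoc, hsucc]
          linarith
    calc _ ≤ ENNReal.ofReal (B * 2 ^ k) + ENNReal.ofReal (24 * B / p - 2 * (B * 2 ^ k)) :=
          add_le_add (hcost k (by omega))
            ((Prog.mean_mono _ hrest).trans (Prog.mean_const _ _ _).le)
      _ = _ := by
          rw [← ENNReal.ofReal_add h0 (by linarith)]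
          congr 1
          ring

/-- Since `x = log N / δ ≥ 2 log 2 > 1.38`, the constant factor in `T/δ ≤ 2.2x` is absorbed into the
power `x⁴`. -/
theorem log_numIter_div_le (hN : 2 ≤ N) {δ : ℝ} (hδ : 0 < δ) (hδ2 : δ ≤ 1 / 2) :
    Real.log (numIter N / δ) ≤ 4 * Real.log (Real.log N / δ) := by
  have hl2 := Real.log_two_gt_d9
  have hl2' := Real.log_two_lt_d9
  have hlN : Real.log 2 ≤ Real.log N := Real.log_le_log (by norm_num) (by exact_mod_cast hN)
  have hT : (0 : ℝ) < numIter N := by exact_mod_cast numIter_pos hN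
  set x := Real.log N / δ with hx
  have hx1 : 1.38 ≤ x := by
    rw [hx, le_div_iff₀ hδ]
    nlinarith
  have hTx : numIter N / δ ≤ 2.2 * x := by
    rw [hx, ← mul_div_assoc]
    apply div_le_div_of_nonneg_right _ hδ.le
    have h1 := numIter_lt (N := N) (by omega)
    have h2 : Real.logb 2 N / 2 ≤ Real.log N * 0.73 := by
      rw [Real.logb, div_div, div_le_iff₀ (by linarith)]
      nlinarith
    linarith
  have hx4 : 2.2 * x ≤ x ^ 4 := by
    have h3 : 2.2 ≤ x ^ 3 := by
      calc (2.2 : ℝ) ≤ 1.38 ^ 3 := by norm_num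
        _ ≤ x ^ 3 := pow_le_pow_left₀ (by norm_num) hx1 3
    nlinarith
  calc _ ≤ Real.log (x ^ 4) := Real.log_le_log (by positivity) (hTx.trans hx4)
    _ = _ := by rw [Real.log_pow]; norm_num

/-- As `2ᵏ ≤ 2√N`, the argument is at most `2⁶N/ε`, and `N/ε ≥ 2` absorbs the constant into the
seventh power. -/
theorem log_sqrt_div_le (hN : 2 ≤ N) (hε : 0 < ε) (hε1 : ε ≤ 1) {k : ℕ} (hk : k ≤ numIter N) :
    Real.log (8 * Real.sqrt N / (ε * 2⁻¹ ^ (k + 2))) ≤ 7 * Real.log (N / ε) := by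
  have hN0 : (2 : ℝ) ≤ N := by exact_mod_cast hN
  have hs : 0 < Real.sqrt N := Real.sqrt_pos.2 (by linarith)
  have h2 : (2 : ℝ) ≤ N / ε := by
    rw [le_div_iff₀ hε]
    linarith
  have h3 : (2 : ℝ) ^ k ≤ 2 * Real.sqrt N :=
    (pow_le_pow_right₀ (by norm_num) hk).trans (two_pow_numIter_le (by omega))
  have h4 : 8 * Real.sqrt N / (ε * 2⁻¹ ^ (k + 2)) = 32 * (Real.sqrt N * 2 ^ k) / ε := by
    rw [inv_pow, pow_add]
    field_simp
    ring
  have h5 : Real.sqrt N * 2 ^ k ≤ 2 * N := by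
    calc _ ≤ Real.sqrt N * (2 * Real.sqrt N) := by gcongr
      _ = 2 * (Real.sqrt N * Real.sqrt N) := by ring
      _ = _ := by rw [Real.mul_self_sqrt (by linarith)]
  calc _ ≤ Real.log ((N / ε) ^ 7) := by
        apply Real.log_le_log (by positivity)
        rw [h4]
        calc _ ≤ 32 * (2 * N) / ε := by gcongr
          _ = 2 ^ 6 * (N / ε) := by ring
          _ ≤ (N / ε) ^ 6 * (N / ε) := by gcongr
          _ = _ := by ring
    _ = _ := by rw [Real.log_pow]; norm_num

/-- The constant is `144 · 8 · 800`, for the repetitions, the truncation degree and the Grover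
iterations. The first two quantities are at least 1 before rounding up (unless `t = 0`), so their
ceilings at most double them. -/
theorem cost_normEstimator_le (W : unitaryGroup (Coined N) ℂ) (hN : 2 ≤ N) (hε : 0 < ε)
    (hε1 : ε ≤ 1) {δ : ℝ} (hδ : 0 < δ) (hδ2 : δ ≤ 1 / 2) {k : ℕ} (hk : k ≤ numIter N) :
    (normEstimator t u (ε * 2⁻¹ ^ (k + 2)) (δ / numIter N)).cost W
      ≤ ENNReal.ofReal (921600 * (Real.sqrt t / ε * Real.log (Real.log N / δ) *
        Real.sqrt (Real.log (N / ε))) * 2 ^ k) := by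
  rw [cost_normEstimator, ← ENNReal.ofReal_natCast]
  apply ENNReal.ofReal_le_ofReal
  have hN0 : (2 : ℝ) ≤ N := by exact_mod_cast hN
  have hl2 := Real.log_two_gt_d9
  have hT : (1 : ℝ) ≤ numIter N := by exact_mod_cast numIter_pos hN
  set ηk := ε * (2⁻¹ : ℝ) ^ (k + 2) with hηk
  have hη0 : 0 < ηk := by positivity
  have hη1 : ηk ≤ 1 / 4 := by
    have : (2⁻¹ : ℝ) ^ k ≤ 1 := pow_le_one₀ (by norm_num) (by norm_num)
    have h0 : (0 : ℝ) ≤ 2⁻¹ ^ k := by positivity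
    rw [hηk, pow_add]
    nlinarith
  have h1 : (⌈18 * Real.log (1 / (δ / numIter N))⌉₊ : ℝ)
      ≤ 144 * Real.log (Real.log N / δ) := by
    rw [one_div_div]
    have hℓ := log_numIter_div_le hN hδ hδ2
    have hℓ2 : Real.log 2 ≤ Real.log (numIter N / δ) := by
      apply Real.log_le_log (by norm_num)
      rw [le_div_iff₀ hδ]
      linarith
    have := Nat.ceil_lt_add_one (a := 18 * Real.log (numIter N / δ)) (by linarith)
    linarith
  have h2 : (⌈Real.sqrt (2 * t * Real.log (8 * Real.sqrt N / ηk))⌉₊ : ℝ)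
      ≤ 8 * (Real.sqrt t * Real.sqrt (Real.log (N / ε))) := by
    rcases Nat.eq_zero_or_pos t with rfl | ht
    · simp
    · have ht1 : (1 : ℝ) ≤ t := by exact_mod_cast ht
      have hlog := log_sqrt_div_le hN hε hε1 hk
      rw [← hηk] at hlog
      have hlow : Real.log 2 ≤ Real.log (8 * Real.sqrt N / ηk) := by
        apply Real.log_le_log (by norm_num)
        rw [le_div_iff₀ hη0]
        have : 1 ≤ Real.sqrt N := Real.one_le_sqrt.2 (by linarith)
        linarith
      set y := Real.sqrt (2 * t * Real.log (8 * Real.sqrt N / ηk)) with hy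
      have hy1 : 1 ≤ y := by
        rw [hy, Real.one_le_sqrt]
        nlinarith
      have hyle : y ≤ 4 * (Real.sqrt t * Real.sqrt (Real.log (N / ε))) := by
        rw [hy, ← Real.sqrt_mul (by linarith)]
        apply Real.sqrt_le_iff.2
        refine ⟨by positivity, ?_⟩
        rw [mul_pow, Real.sq_sqrt (mul_nonneg (by linarith) (by linarith))]
        have h4 := mul_le_mul_of_nonneg_left hlog (zero_le_one.trans ht1)
        have h5 : 0 ≤ t * Real.log (N / ε) := mul_nonneg (by linarith) (by linarith)
        linarith
      have := Nat.ceil_lt_add_one (a := y) (by linarith)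
      linarith
  have h3 : 2 * (⌈4 * Real.pi / (ηk / 2 / 3)⌉₊ : ℝ) + 1 ≤ 800 * (2 ^ k / ε) := by
    have hpos : 0 ≤ 4 * Real.pi / (ηk / 2 / 3) := by positivity
    have hc := Nat.ceil_lt_add_one hpos
    have h5 : 4 * Real.pi / (ηk / 2 / 3) = 24 * Real.pi * (1 / ηk) := by
      field_simp
      norm_num
    have h6 : 1 / ηk = 4 * (2 ^ k / ε) := by
      rw [hηk, inv_pow, pow_add]
      field_simp
      norm_num
    have h7 : 4 ≤ 1 / ηk := by
      rw [le_div_iff₀ hη0]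
      linarith
    rw [h5] at hc
    rw [h5]
    have := Real.pi_lt_d2
    have h8 : 24 * Real.pi * (1 / ηk) ≤ 24 * 3.15 * (1 / ηk) := by gcongr
    linarith
  push_cast
  have hLL : 0 ≤ 144 * Real.log (Real.log N / δ) := (Nat.cast_nonneg _).trans h1
  calc _ ≤ (144 * Real.log (Real.log N / δ)) *
        ((8 * (Real.sqrt t * Real.sqrt (Real.log (N / ε)))) * (800 * (2 ^ k / ε))) := by
        gcongr
    _ = _ := by ring

end Multiplicative

end QFF

end

/-! ### The main theorem. -/

theorem mainTheorem7 :
    ∃ C : ℝ, 0 < C ∧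
      ∀ (N d : ℕ) (_ : 2 ≤ N) (G : SimpleGraph (Fin N)) [DecidableRel G.Adj]
        (_ : ∀ v, G.degree v ≤ d) (V : QFF.CoinToss (QFF.transition G d))
        (u : Fin N) (t : ℕ) (ε δ : ℝ) (_ : 0 < ε) (_ : 0 < δ) (_ : δ < 1),
        ENNReal.ofReal (1 - δ) ≤
            ((QFF.multNormEstimator t u ε δ).exec (QFF.walkStep G V)).toOuterMeasure
              {r | |QFF.walkNorm (QFF.transition G d) t u - r.1| ≤
                ε * QFF.walkNorm (QFF.transition G d) t u} ∧
          (ε ≤ 1 → δ ≤ 1 / 2 →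
            ∑' r, ((QFF.multNormEstimator t u ε δ).exec (QFF.walkStep G V)) r * (r.2 : ENNReal) ≤
              ENNReal.ofReal (C * (Real.sqrt t / (ε * QFF.walkNorm (QFF.transition G d) t u) *
                Real.log (Real.log N / δ) * Real.sqrt (Real.log (N / ε))))) := by
  refine ⟨24 * 921600, by norm_num, ?_⟩
  intro N d hN G _ hd V u t ε δ hε hδ hδ1
  set p := QFF.walkNorm (QFF.transition G d) t u with hp
  have hTpos := QFF.numIter_pos hN
  have hT : (1 : ℝ) ≤ QFF.numIter N := by exact_mod_cast hTpos
  have hδ' : 0 < δ / QFF.numIter N := by positivity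
  have hδ'1 : δ / QFF.numIter N < 1 := by
    rw [div_lt_one (by linarith)]
    linarith
  refine ⟨?_, fun hε1 hδ2 => ?_⟩
  · refine QFF.Prog.le_toOuterMeasure_of_mean_compl_le (QFF.walkStep G V)
      (QFF.multNormEstimator t u ε δ) {b | |p - b| ≤ ε * p} hδ.le ?_
    refine (QFF.mean_multLoop_le t u G hd V hε hδ' hδ'1 _ 1 0 (add_comm _ _)
      fun h => absurd h hTpos.ne').trans ?_
    rw [← ENNReal.ofReal_natCast, ← ENNReal.ofReal_mul (by positivity),
      mul_div_cancel₀ _ (by positivity)]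
  · have hp0 : 0 < p := by
      have h := QFF.one_le_sqrt_mul_walkNorm t u G (d := d)
      rw [← hp] at h
      by_contra! hneg
      nlinarith [Real.sqrt_nonneg (N : ℝ)]
    have hp1 : p ≤ 1 := QFF.walkNorm_le_one t u G hd V
    have hLL : 0 ≤ Real.log (Real.log N / δ) := by
      have h1 := QFF.log_numIter_div_le hN hδ hδ2
      have h2 : 0 ≤ Real.log (QFF.numIter N / δ) := by
        apply Real.log_nonneg
        rw [le_div_iff₀ hδ]
        linarith
      linarith
    set B : ℝ := 921600 * (Real.sqrt t / ε * Real.log (Real.log N / δ) *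
      Real.sqrt (Real.log (N / ε))) with hB
    have hB0 : 0 ≤ B := by positivity
    -- The loop starts in the expensive regime's favour of the geometric series: `p ≤ 1` gives `2¹p
    -- < 4`. For `T ≥ 2`, `δ ≤ 1/2` gives `δ/T ≤ 1/4`.
    refine (QFF.cost_multLoop_le t u G hd V hB0 hε hε1 hδ' hδ'1 (fun h2 => ?_)
      (fun k hk => QFF.cost_normEstimator_le t u _ hN hε hε1 hδ hδ2 hk) hp0 _ 1 0 le_rfl
      (add_comm _ _) (by linarith)).trans (ENNReal.ofReal_le_ofReal ?_)
    · have h2' : (2 : ℝ) ≤ QFF.numIter N := by exact_mod_cast h2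
      rw [div_le_iff₀ (by linarith)]
      linarith
    · rw [← hp]
      have : 24 * B / p = 24 * 921600 * (Real.sqrt t / (ε * p) *
          Real.log (Real.log N / δ) * Real.sqrt (Real.log (N / ε))) := by
        rw [hB]
        field_simp
      linarith
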